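/- **Corollary 1.6.** Let $p:\mathbb R^2\to[1,\infty)$ be measurable, let $p_-$ and $p_+$ be its essential infimum and essential supremum, and assume $2\le p_-\le p_+<\infty$. Suppose that $p$ is locally log-Hölder continuous, i.e. there is $c_0>0$ with $$|p(x)-p(y)|\,\log\frac1{|x-y|}\le c_0\qquad(x,y\in\mathbb R^2,\ |x-y|<1),$$ the left side being read as $0$ when $x=y$, and log-Hölder continuous at infinity, i.e. there are real constants $c_\infty$ and $p(\infty)$ with $$|p(x)-p(\infty)|\,\log(e+|x|)\le c_\infty\qquad(x\in\mathbb R^2).$$ Let $L^{p(\cdot)}(\mathbb R^2)$ be the space of measurable $f$ on $\mathbb R^2$ such that $\int_{\mathbb R^2}(|f(x)|/\lambda)^{p(x)}\,dx<\infty$ for some $\lambda>0$, with norm $$\|f\|_{p(\cdot)}=\inf\Big\{\lambda>0:\int_{\mathbb R^2}\Big(\frac{|f(x)|}{\lambda}\Big)^{p(x)}dx\le1\Big\}.$$ For real $N\ge 2$ let $\mathcal B_N$ be the set of all rectangles in $\mathbb R^2$, of arbitrary position, direction and size, whose ratio of long side to short side equals $N$, and let $$K_Nf(x)=\sup_{R\in\mathcal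 B_N,\ x\in R}\frac1{|R|}\int_R|f(y)|\,dy,\qquad C_N=\sup_{x,y\in\mathbb R^2,\ |x-y|<\sqrt N}\left|\frac1{p(x)}-\frac1{p(y)}\right|.$$ Then there is a constant $C>0$, independent of $N$ (it may depend on $p(\cdot)$), such that for every real $N\ge2$ the operator $K_N$ is bounded from $L^{p(\cdot)}(\mathbb R^2)$ to $L^{p(\cdot)}(\mathbb R^2)$ and its operator norm satisfies $$\|K_N\|_{L^{p(\cdot)}(\mathbb R^2)\to L^{p(\cdot)}(\mathbb R^2)}\le C\,N^{p_-C_N}(\log N)^{2/p_-}.$$ -/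

import Mathlib

open MeasureTheory
open scoped ENNReal

noncomputable section

namespace KakeyaVar

/-- The Euclidean plane. -/
abbrev Plane : Type := EuclideanSpace ℝ (Fin 2)

/-- The essential infimum of the exponent `p` over the plane, with values in `[-∞, ∞]`. -/
def pMinus (p : Plane → ℝ) : EReal := essInf (fun x => (p x : EReal)) volume

/-- The essential supremum of the exponent `p` over the plane, with values in `[-∞, ∞]`. -/
def pPlus (p : Plane → ℝ) : EReal := essSup (fun x => (p x : EReal)) volume

/-- Local log-Hölder continuity. At `x = y` the left side vanishes because its first factor is `0`. -/
def LocallyLogHolder (p : Plane → ℝ) : Prop :=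
  ∃ c₀ : ℝ, 0 < c₀ ∧ ∀ x y : Plane, ‖x - y‖ < 1 →
    |p x - p y| * Real.log (1 / ‖x - y‖) ≤ c₀

/-- Log-Hölder continuity at infinity. -/
def LogHolderAtInfinity (p : Plane → ℝ) : Prop :=
  ∃ c pInf : ℝ, ∀ x : Plane, |p x - pInf| * Real.log (Real.exp 1 + ‖x‖) ≤ c

section Space

variable {ε : Type*} [TopologicalSpace ε] [ContinuousENorm ε]

/-- The modular `ρ(f / r) = ∫ (|f(x)| / r) ^ p(x) dx`, with values in `[0, ∞]`. The values of `f` may be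
real numbers, or elements of `[0, ∞]` (as for a maximal function). -/
def modular (p : Plane → ℝ) (f : Plane → ε) (r : ℝ) : ℝ≥0∞ :=
  ∫⁻ x, (‖f x‖ₑ / ENNReal.ofReal r) ^ (p x)

/-- Membership in the variable Lebesgue space: `f` is Lebesgue measurable and some `ρ(f / r)`, `r > 0`,
is finite. For a `[0, ∞]`-valued `f` and a positive exponent this forces `f` to be finite almost everywhere. -/
def MemVarLp (p : Plane → ℝ) (f : Plane → ε) : Prop :=
  AEStronglyMeasurable f volume ∧ ∃ r : ℝ, 0 < r ∧ modular p f r < ∞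

/-- The Luxemburg norm `inf {r > 0 : ρ(f / r) ≤ 1}`, an infimum in `[0, ∞]`. -/
def varNorm (p : Plane → ℝ) (f : Plane → ε) : ℝ≥0∞ :=
  ⨅ (r : ℝ) (_ : 0 < r) (_ : modular p f r ≤ 1), ENNReal.ofReal r

end Space

/-- The operator norm of `T` on the variable Lebesgue space: the infimum in `[0, ∞]` of all `A` with
`‖T f‖ ≤ A ‖f‖` for every `f` in the space. -/
def opNorm (p : Plane → ℝ) (T : (Plane → ℝ) → Plane → ℝ≥0∞) : ℝ≥0∞ :=
  sInf {A : ℝ≥0∞ | ∀ f : Plane → ℝ, MemVarLp p f → varNorm p (T f) ≤ A * varNorm p f}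

/-- `T` is bounded from the variable Lebesgue space to itself. -/
def IsBoundedOp (p : Plane → ℝ) (T : (Plane → ℝ) → Plane → ℝ≥0∞) : Prop :=
  (∀ f : Plane → ℝ, MemVarLp p f → MemVarLp p (T f)) ∧ opNorm p T < ∞

/-- The closed rectangle with centre `c` whose sides are parallel to the orthonormal vectors
`e 0`, `e 1` and have lengths `a`, `b` respectively. -/
def rectangle (e : OrthonormalBasis (Fin 2) ℝ Plane) (c : Plane) (a b : ℝ) : Set Plane :=
  {y | |inner ℝ (e 0) (y - c)| ≤ a / 2 ∧ |inner ℝ (e 1) (y - c)| ≤ b / 2}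

/-- The set of all rectangles, of arbitrary position, direction and size, whose side lengths have
ratio `N`. -/
def rectangles (N : ℝ) : Set (Set Plane) :=
  {R | ∃ (e : OrthonormalBasis (Fin 2) ℝ Plane) (c : Plane) (a : ℝ),
    0 < a ∧ R = rectangle e c a (N * a)}

/-- The Kakeya (Nikodym) maximal operator: the supremum of the averages of `|f|` over the rectangles of
eccentricity `N` that contain `x`. -/
def kakeya (N : ℝ) (f : Plane → ℝ) (x : Plane) : ℝ≥0∞ :=
  ⨆ (R : Set Plane) (_ : R ∈ rectangles N) (_ : x ∈ R), ⨍⁻ y in R, ‖f y‖ₑ ∂volume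

/-- The supremum of `|1/p(x) - 1/p(y)|` over `|x - y| < √N`. For `p ≥ 1` and `N > 0` it is the supremum of
a nonempty set of real numbers in `[0, 1]`. -/
def oscConst (p : Plane → ℝ) (N : ℝ) : ℝ :=
  sSup {t : ℝ | ∃ x y : Plane, ‖x - y‖ < Real.sqrt N ∧ t = |1 / p x - 1 / p y|}

end KakeyaVar

end

/-! The variable exponent is reduced to the constant exponent `2`, where a logarithmic bound holds.

The `L²` bound, `‖K_N g‖₂ ≤ C log N ‖g‖₂` (`exists_lintegral_kakeyaMax_sq_le`). Rectangles are
replaced by Gaussian averages over dyadic parallelograms of length `2 ^ k`, eccentricity `2 ^ l` and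
slope `j / 2 ^ l`. The average at `(l + 1, j, k)` is compared with its parent at `(l, j / 2, k)`.
These averages are Fourier multipliers, and the squared differences of the multipliers, summed over
all `j` and `k`, are bounded uniformly in `l` and in the frequency. By Plancherel the square
function of the differences is bounded on `L²` uniformly in `l`
(`tsum_lintegral_gaussAvgC_sub_sq_le`). Telescoping from eccentricity `2 ^ n` to eccentricity one,
where the Hardy–Littlewood maximal function dominates, uses `n` such square functions, and `n` is
comparable to `log N`.

Passage to `p(·)`. Let `∫ g ^ p ≤ 1`, and split `g` at height `1`. For the large part, Jensen with
the minimum of `p` over a rectangle `R` gives `K_N g (x) ^ p(x) ≲ K_N(g ^ (p / 2)) (x) ^ 2` up to a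
power of `|R|⁻¹`. If `R` is shorter than about `√N`, then `|R|` is its squared length over `N`:
log-Hölder continuity controls the power of the length, and the power of `N` costs `N ^ oscConst`
(`exists_inv_rpow_le`). If `R` is longer, `|R|` is bounded below and nothing is lost. For the small
part, `p` is exchanged for its limit at infinity and back, with an error in `L²`
(`exists_kakeyaMax_rpow_le_of_small`). As `g ^ (p / 2)` has `L²` norm at most `1`, the modular of
`K_N g / (C N ^ oscConst)` is `O(log² N)`; dividing further by the `1 / p₋` power of that bound
brings it below `1` and produces `(log N) ^ (2 / p₋)`. The power of `N` obtained this way is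
`oscConst`, smaller than the stated `p₋ * oscConst`. -/

open scoped NNReal

noncomputable section

namespace KakeyaVar

/-! ### Plancherel's theorem for the Fourier integral -/

section Plancherel

open FourierTransform SchwartzMap

variable {E : Type*} [NormedAddCommGroup E] [InnerProductSpace ℝ E] [FiniteDimensional ℝ E]
  [MeasurableSpace E] [BorelSpace E]

/-- The `L²` Fourier transform of an integrable function is given by the Fourier integral. -/
theorem fourier_toLp_ae_eq {u : E → ℂ} (h1 : Integrable u) (h2 : MemLp u 2) :
    ((𝓕 (h2.toLp u) : Lp (α := E) ℂ 2) : E → ℂ) =ᵐ[volume] 𝓕 u := by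
  have hcont : Continuous (𝓕 u) :=
    VectorFourier.fourierIntegral_continuous Real.continuous_fourierChar
      (by exact continuous_inner) h1
  -- Both functions are tested against smooth compactly supported functions; on each side the
  -- transform can be moved onto the test function.
  refine ae_eq_of_integral_contDiff_smul_eq
    ((Lp.memLp _).locallyIntegrable (by norm_num)) hcont.locallyIntegrable ?_
  intro φ hφ hφc
  have hφ' : ContDiff ℝ ((⊤ : ℕ∞) : WithTop ℕ∞) (Complex.ofRealCLM ∘ φ) := by fun_prop
  have hφc' : HasCompactSupport (Complex.ofRealCLM ∘ φ) := hφc.comp_left rfl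
  set ψ : 𝓢(E, ℂ) := hφc'.toSchwartzMap hφ' with hψ
  have key := congrArg (fun T => T ψ) (Lp.fourier_toTemperedDistribution_eq (h2.toLp u))
  simp only [TemperedDistribution.fourier_apply, Lp.toTemperedDistribution_apply] at key
  have e1 : ∀ x, ψ x = (φ x : ℂ) := fun x => rfl
  have e2 : ∀ f : E → ℂ, ∫ x, φ x • f x = ∫ x, ψ x • f x := fun f => by
    simp [e1]
  have e3 : ∫ x, (𝓕 ψ) x • (h2.toLp u : E → ℂ) x = ∫ x, (𝓕 ψ) x • u x := by
    refine integral_congr_ae ?_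
    filter_upwards [h2.coeFn_toLp] with x hx
    rw [hx]
  have e4 : ∫ x, (𝓕 ψ) x • u x = ∫ x, ψ x • (𝓕 u) x := by
    rw [fourier_coe]
    have := VectorFourier.integral_fourierIntegral_smul_eq_flip (L := innerₗ E) (μ := volume)
      (ν := volume) Real.continuous_fourierChar (by exact continuous_inner) ψ.integrable h1
    rw [flip_innerₗ] at this
    exact this
  rw [e2, e2, ← key, e3, e4]

/-- Plancherel's theorem for functions in `L¹ ∩ L²`. -/
theorem lintegral_enorm_fourier_sq {u : E → ℂ} (h1 : Integrable u) (h2 : MemLp u 2) :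
    ∫⁻ ξ, ‖𝓕 u ξ‖ₑ ^ 2 = ∫⁻ x, ‖u x‖ₑ ^ 2 := by
  have h : eLpNorm (𝓕 u) 2 volume = eLpNorm u 2 volume := by
    rw [← eLpNorm_congr_ae (fourier_toLp_ae_eq h1 h2), ← Lp.enorm_def, ← ofReal_norm,
      Lp.norm_fourier_eq, ofReal_norm, Lp.enorm_def, eLpNorm_congr_ae h2.coeFn_toLp]
  have e := fun v : E → ℂ => eLpNorm_nnreal_pow_eq_lintegral (μ := volume) (f := v)
    (p := 2) (by norm_num)
  have := congrArg (fun t => t ^ (2 : ℝ)) h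
  simpa [e] using (e _).symm.trans ((congrArg (fun t => t ^ (2 : ℝ)) h).trans (e _))

end Plancherel

/-! ### Gaussian averages and their Fourier multipliers -/

section Gaussian

open FourierTransform

/-- Jensen's inequality for the power function and a probability measure. -/
theorem lintegral_rpow_le_of_prob {α : Type*} [MeasurableSpace α] {μ : Measure α}
    [IsProbabilityMeasure μ] {f : α → ℝ≥0∞} (hf : AEMeasurable f μ) {r : ℝ} (hr : 1 ≤ r) :
    (∫⁻ x, f x ∂μ) ^ r ≤ ∫⁻ x, f x ^ r ∂μ := by
  rcases hr.eq_or_lt with rfl | hr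
  · simp
  have h := ENNReal.lintegral_mul_le_Lp_mul_Lq μ (Real.HolderConjugate.conjExponent hr) hf
    (aemeasurable_const (b := (1 : ℝ≥0∞)))
  simp only [Pi.mul_apply, mul_one, ENNReal.one_rpow, lintegral_const, measure_univ] at h
  calc (∫⁻ x, f x ∂μ) ^ r ≤ ((∫⁻ x, f x ^ r ∂μ) ^ (1 / r)) ^ r := by gcongr
    _ = _ := by rw [← ENNReal.rpow_mul, one_div_mul_cancel (by linarith), ENNReal.rpow_one]

theorem lintegral_sq_le_of_prob {α : Type*} [MeasurableSpace α] {μ : Measure α}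
    [IsProbabilityMeasure μ] {f : α → ℝ≥0∞} (hf : AEMeasurable f μ) :
    (∫⁻ x, f x ∂μ) ^ 2 ≤ ∫⁻ x, f x ^ 2 ∂μ := by
  simpa using lintegral_rpow_le_of_prob hf (r := 2) (by norm_num)

/-- The Gaussian probability measure with density `exp (-π ‖w‖²)`. -/
def gaussMeasure : Measure Plane :=
  volume.withDensity fun w => ENNReal.ofReal (Real.exp (-Real.pi * ‖w‖ ^ 2))

instance : IsProbabilityMeasure gaussMeasure where
  measure_univ := by
    have h := GaussianFourier.integral_rexp_neg_mul_sq_norm (V := Plane) Real.pi_pos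
    rw [div_self Real.pi_ne_zero, Real.one_rpow] at h
    rw [gaussMeasure, withDensity_apply _ MeasurableSet.univ, Measure.restrict_univ,
      ← ofReal_integral_eq_lintegral_ofReal _ (ae_of_all _ fun _ => (Real.exp_pos _).le), h,
      ENNReal.ofReal_one]
    by_contra hc
    rw [integral_undef hc] at h
    exact zero_ne_one h

theorem integral_gaussMeasure (f : Plane → ℂ) :
    ∫ w, f w ∂gaussMeasure = ∫ w, (Real.exp (-Real.pi * ‖w‖ ^ 2) : ℂ) * f w := by
  rw [gaussMeasure, integral_withDensity_eq_integral_toReal_smul₀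
    (by fun_prop) (by simp)]
  refine integral_congr_ae (ae_of_all _ fun w => ?_)
  simp only [ENNReal.toReal_ofReal (Real.exp_pos _).le]
  rfl

/-- The density `exp (-π ‖w‖²)` is its own Fourier transform. This makes the multiplier of every
linear image of the measure an explicit Gaussian. -/
theorem integral_fourierChar_gaussMeasure (η : Plane) :
    ∫ w, (Real.fourierChar (-inner ℝ w η) : ℂ) ∂gaussMeasure =
      (Real.exp (-Real.pi * ‖η‖ ^ 2) : ℂ) := by
  have h := fourier_gaussian_innerProductSpace (V := Plane) (b := (Real.pi : ℂ))
    (by simpa using Real.pi_pos) η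
  rw [Real.fourier_eq] at h
  rw [integral_gaussMeasure]
  have hpi : (Real.pi : ℂ) ≠ 0 := by exact_mod_cast Real.pi_ne_zero
  rw [div_self hpi, Complex.one_cpow, one_mul] at h
  convert h using 1
  · refine integral_congr_ae (ae_of_all _ fun w => ?_)
    simp only [Circle.smul_def, smul_eq_mul]
    push_cast
    ring
  · push_cast
    congr 1
    field_simp

variable {B B' : Plane → Plane}

/-- The averages of `g` against the image of the Gaussian measure under `B`. -/
def gaussAvgC (B : Plane → Plane) (g : Plane → ℂ) (x : Plane) : ℂ :=
  ∫ w, g (x - B w) ∂gaussMeasure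

/-- The averages of a nonnegative `g` against the image of the Gaussian measure under `B`. -/
def gaussAvg (B : Plane → Plane) (g : Plane → ℝ≥0∞) (x : Plane) : ℝ≥0∞ :=
  ∫⁻ w, g (x - B w) ∂gaussMeasure

theorem measurable_gaussAvg (hB : Measurable B) {g : Plane → ℝ≥0∞} (hg : Measurable g) :
    Measurable (gaussAvg B g) :=
  Measurable.lintegral_prod_right' (f := fun q : Plane × Plane => g (q.1 - B q.2)) (by fun_prop)

theorem lintegral_gaussAvg (hB : Measurable B) {g : Plane → ℝ≥0∞} (hg : Measurable g) :
    ∫⁻ x, gaussAvg B g x = ∫⁻ x, g x := by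
  simp only [gaussAvg]
  rw [lintegral_lintegral_swap (by fun_prop)]
  simp [lintegral_sub_right_eq_self (μ := (volume : Measure Plane)) g]

theorem lintegral_gaussAvg_sq_le (hB : Measurable B) {g : Plane → ℝ≥0∞} (hg : Measurable g) :
    ∫⁻ x, gaussAvg B g x ^ 2 ≤ ∫⁻ x, g x ^ 2 := by
  rw [← lintegral_gaussAvg hB (hg.pow_const 2)]
  exact lintegral_mono fun x => lintegral_sq_le_of_prob (by fun_prop)

theorem enorm_gaussAvgC_le (g : Plane → ℂ) (x : Plane) :
    ‖gaussAvgC B g x‖ₑ ≤ gaussAvg B (fun y => ‖g y‖ₑ) x :=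
  enorm_integral_le_lintegral_enorm _

variable {g : Plane → ℂ}

theorem integrable_prod_gauss (hB : Measurable B) (hg : Measurable g) (h1 : Integrable g) :
    Integrable (fun q : Plane × Plane => g (q.1 - B q.2)) (volume.prod gaussMeasure) := by
  have hm : Measurable (fun q : Plane × Plane => g (q.1 - B q.2)) := by fun_prop
  refine ⟨hm.aestronglyMeasurable, ?_⟩
  rw [hasFiniteIntegral_iff_enorm, lintegral_prod _ hm.enorm.aemeasurable]
  exact (lintegral_gaussAvg hB hg.enorm).trans_lt h1.2

theorem integrable_gaussAvgC (hB : Measurable B) (hg : Measurable g) (h1 : Integrable g) :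
    Integrable (gaussAvgC B g) :=
  (integrable_prod_gauss hB hg h1).integral_prod_left

theorem memLp_gaussAvgC (hB : Measurable B) (hg : Measurable g) (h1 : Integrable g)
    (h2 : MemLp g 2) : MemLp (gaussAvgC B g) 2 := by
  refine ⟨(integrable_gaussAvgC hB hg h1).1, ?_⟩
  have h := h2.2
  rw [eLpNorm_lt_top_iff_lintegral_rpow_enorm_lt_top (by norm_num) (by norm_num)] at h ⊢
  simp only [ENNReal.toReal_ofNat, ENNReal.rpow_ofNat] at h ⊢
  refine lt_of_le_of_lt ?_ h
  refine le_trans (lintegral_mono fun x => ?_) (lintegral_gaussAvg_sq_le hB hg.enorm)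
  gcongr
  exact enorm_gaussAvgC_le g x

/-- Gaussian averages are Fourier multiplier operators. -/
theorem fourier_gaussAvgC (hB : Measurable B) (hBB' : ∀ w ξ, inner ℝ (B w) ξ = inner ℝ w (B' ξ))
    (hg : Measurable g) (h1 : Integrable g) (ξ : Plane) :
    𝓕 (gaussAvgC B g) ξ = 𝓕 g ξ * (Real.exp (-Real.pi * ‖B' ξ‖ ^ 2) : ℂ) := by
  rw [Real.fourier_eq]
  have hI : Integrable (fun q : Plane × Plane =>
      Real.fourierChar (-inner ℝ q.1 ξ) • g (q.1 - B q.2)) (volume.prod gaussMeasure) := by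
    have hc : Continuous fun q : Plane × Plane => Real.fourierChar (-inner ℝ q.1 ξ) :=
      Real.continuous_fourierChar.comp (by fun_prop)
    have hm : Measurable (fun q : Plane × Plane => g (q.1 - B q.2)) := by fun_prop
    exact (integrable_prod_gauss hB hg h1).mono
      (hc.aestronglyMeasurable.smul hm.aestronglyMeasurable) (ae_of_all _ fun q => by simp)
  calc ∫ x, Real.fourierChar (-inner ℝ x ξ) • gaussAvgC B g x
      = ∫ x, ∫ w, Real.fourierChar (-inner ℝ x ξ) • g (x - B w) ∂gaussMeasure := by
        refine integral_congr_ae (ae_of_all _ fun x => ?_)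
        simp only [gaussAvgC, Circle.smul_def, integral_smul]
    _ = ∫ w, (∫ x, Real.fourierChar (-inner ℝ x ξ) • g (x - B w)) ∂gaussMeasure :=
        integral_integral_swap hI
    _ = ∫ w, (Real.fourierChar (-inner ℝ w (B' ξ)) : ℂ) * 𝓕 g ξ ∂gaussMeasure := by
        refine integral_congr_ae (ae_of_all _ fun w => ?_)
        simp only
        rw [← integral_add_right_eq_self _ (B w), Real.fourier_eq, ← integral_const_mul]
        refine integral_congr_ae (ae_of_all _ fun x => ?_)
        simp only [add_sub_cancel_right, inner_add_left, neg_add, AddChar.map_add_eq_mul,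
          Circle.smul_def, smul_eq_mul, Circle.coe_mul, hBB']
        ring
    _ = _ := by
        rw [integral_mul_const, integral_fourierChar_gaussMeasure, mul_comm]

end Gaussian

/-! ### Multiplier differences and the square function -/

section SquareFunction

theorem abs_exp_neg_sub_exp_neg_le {x y m : ℝ} (hx : m ≤ x) (hy : m ≤ y) :
    |Real.exp (-x) - Real.exp (-y)| ≤ |x - y| * Real.exp (-m) := by
  wlog h : x ≤ y generalizing x y
  · rw [abs_sub_comm, abs_sub_comm x y]
    exact this hy hx (le_of_not_ge h)
  have h1 : Real.exp (-y) = Real.exp (-x) * Real.exp (-(y - x)) := by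
    rw [← Real.exp_add]; congr 1; ring
  have h2 := Real.add_one_le_exp (-(y - x))
  have h3 : Real.exp (-y) ≤ Real.exp (-x) := Real.exp_le_exp.2 (by linarith)
  have h4 : Real.exp (-x) ≤ Real.exp (-m) := Real.exp_le_exp.2 (by linarith)
  rw [abs_of_nonneg (by linarith), abs_of_nonpos (by linarith), h1]
  nlinarith [Real.exp_pos (-x), Real.exp_pos (-m), mul_le_mul_of_nonneg_left h4 (sub_nonneg.2 h)]

theorem one_add_pow_four_le_exp {A : ℝ} (hA : 0 ≤ A) : (1 + A) ^ 4 ≤ 256 * Real.exp A := by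
  have h := Real.add_one_le_exp (A / 4)
  have h1 : 1 + A ≤ 4 * Real.exp (A / 4) := by linarith
  calc (1 + A) ^ 4 ≤ (4 * Real.exp (A / 4)) ^ 4 := by gcongr
    _ = 256 * Real.exp A := by
      rw [mul_pow, ← Real.exp_nat_mul]; norm_num; ring_nf

/-- The pairs `(u, w)` and `(u', 2 * w)` are one frequency in the coordinates of a parallelogram and
of its parent. The exponents differ by at most a multiple of `|w| * √A` with `A = u ^ 2 + w ^ 2`,
whence the factor `w ^ 2`. Both exponents are at least `π * A / 2`, so the square of the difference
keeps a factor `exp (-π * A)`, which pays for the polynomial denominator. -/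
theorem sq_exp_sub_exp_le {u u' w : ℝ} (h : |u - u'| ≤ |w|) :
    (Real.exp (-Real.pi * (u ^ 2 + w ^ 2)) - Real.exp (-Real.pi * (u' ^ 2 + 4 * w ^ 2))) ^ 2 ≤
      51200 * w ^ 2 / ((1 + u ^ 2) * (1 + w ^ 2) ^ 2) := by
  set A := u ^ 2 + w ^ 2 with hA
  set A' := u' ^ 2 + 4 * w ^ 2 with hA'
  have hA0 : 0 ≤ A := by positivity
  have hw : (u - u') ^ 2 ≤ w ^ 2 := sq_le_sq.2 h
  have hAA' : A / 2 ≤ A' := by nlinarith [sq_nonneg (u' - (u - u'))]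
  have hpi := Real.pi_pos
  have hpi3 := Real.pi_gt_three
  have h1 := abs_exp_neg_sub_exp_neg_le (x := Real.pi * A) (y := Real.pi * A')
    (m := Real.pi * (A / 2)) (by nlinarith) (by nlinarith)
  have h2 : |A - A'| ≤ |w| * (2 * |u| + 4 * |w|) := by
    have e : A - A' = (u - u') * (2 * u - (u - u')) - 3 * w * w := by rw [hA, hA']; ring
    rw [e]
    calc |(u - u') * (2 * u - (u - u')) - 3 * w * w|
        ≤ |(u - u') * (2 * u - (u - u'))| + |3 * w * w| := abs_sub _ _
      _ = |u - u'| * |2 * u - (u - u')| + 3 * |w| * |w| := by simp [abs_mul]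
      _ ≤ |w| * (|2 * u| + |w|) + 3 * |w| * |w| := by
          gcongr
          exact (abs_sub _ _).trans (by gcongr)
      _ = _ := by rw [abs_mul]; norm_num; ring
  have h3 : (A - A') ^ 2 ≤ 20 * w ^ 2 * A := by
    rw [← sq_abs]
    calc |A - A'| ^ 2 ≤ (|w| * (2 * |u| + 4 * |w|)) ^ 2 := by gcongr
      _ ≤ 20 * |w| ^ 2 * (|u| ^ 2 + |w| ^ 2) := by
          nlinarith [mul_nonneg (sq_nonneg |w|) (sq_nonneg (4 * |u| - 2 * |w|))]
      _ = _ := by simp only [sq_abs]; rfl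
  have h4 : (Real.exp (-(Real.pi * A)) - Real.exp (-(Real.pi * A'))) ^ 2 ≤
      Real.pi ^ 2 * (20 * w ^ 2 * A) * Real.exp (-(Real.pi * A)) := by
    rw [← sq_abs]
    calc _ ≤ (|Real.pi * A - Real.pi * A'| * Real.exp (-(Real.pi * (A / 2)))) ^ 2 := by gcongr
      _ = Real.pi ^ 2 * (A - A') ^ 2 * Real.exp (-(Real.pi * A)) := by
          rw [mul_pow, sq_abs, ← Real.exp_nat_mul]; push_cast; ring_nf
      _ ≤ _ := by gcongr
  have h5 : Real.exp (-(Real.pi * A)) * (1 + A) ^ 4 ≤ 256 := by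
    have := one_add_pow_four_le_exp hA0
    calc _ ≤ Real.exp (-A) * (256 * Real.exp A) := by
          gcongr
          nlinarith
      _ = 256 := by rw [mul_left_comm, ← Real.exp_add]; simp
  have h6 : (1 + u ^ 2) * (1 + w ^ 2) ^ 2 ≤ (1 + A) ^ 3 := by
    calc _ ≤ (1 + A) * (1 + A) ^ 2 := by
          gcongr <;> simp only [hA] <;> nlinarith [sq_nonneg u, sq_nonneg w]
      _ = _ := by ring
  rw [neg_mul, neg_mul, le_div_iff₀ (by positivity)]
  have hpi10 : Real.pi ^ 2 ≤ 10 := by nlinarith [Real.pi_lt_d2]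
  calc _ ≤ Real.pi ^ 2 * (20 * w ^ 2 * A) * Real.exp (-(Real.pi * A)) * (1 + A) ^ 3 := by gcongr
    _ ≤ 10 * (20 * w ^ 2 * (1 + A)) * Real.exp (-(Real.pi * A)) * (1 + A) ^ 3 := by
        gcongr; linarith
    _ = 200 * w ^ 2 * (Real.exp (-(Real.pi * A)) * (1 + A) ^ 4) := by ring
    _ ≤ 200 * w ^ 2 * 256 := by gcongr
    _ = _ := by ring

theorem tsum_int_eq (f : ℤ → ℝ≥0∞) :
    ∑' j, f j = (∑' n : ℕ, f n) + ∑' n : ℕ, f (-(n + 1)) :=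
  (HasSum.of_nat_of_neg_add_one ENNReal.summable.hasSum ENNReal.summable.hasSum).tsum_eq

/-- With `t = (m + 1) * w`, the inequality `(1 + t) ^ 2 ≤ 2 * (1 + t ^ 2)` bounds each new term by a
telescoping difference. -/
theorem sum_inv_one_add_sq_le {w : ℝ} (hw : 0 < w) (m : ℕ) :
    ∑ n ∈ Finset.range m, 1 / (1 + (n * w) ^ 2) ≤ 1 + 2 / w := by
  have key : ∀ m : ℕ, ∑ n ∈ Finset.range (m + 1), 1 / (1 + (n * w) ^ 2) ≤
      1 + 2 / w * (1 - 1 / (1 + m * w)) := by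
    intro m
    induction m with
    | zero => simp
    | succ m ih =>
      rw [Finset.sum_range_succ]
      have h : 1 / (1 + ((m + 1 : ℕ) * w) ^ 2) ≤
          2 / w * (1 / (1 + m * w) - 1 / (1 + (m + 1 : ℕ) * w)) := by
        have e : 2 / w * (1 / (1 + m * w) - 1 / (1 + (m + 1 : ℕ) * w)) =
            2 / ((1 + m * w) * (1 + (m + 1 : ℕ) * w)) := by
          push_cast; field_simp; ring
        rw [e, div_le_div_iff₀ (by positivity) (by positivity)]
        push_cast
        have : (0 : ℝ) ≤ m * w := by positivity
        nlinarith [sq_nonneg ((m + 1 : ℝ) * w - 1)]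
      linarith
  rcases m with _ | m
  · simp; positivity
  · refine (key m).trans ?_
    have : 0 ≤ 2 / w * (1 / (1 + m * w)) := by positivity
    linarith

theorem tsum_inv_one_add_sq_nat_le {w : ℝ} (hw : 0 < w) {y : ℕ → ℝ}
    (hy : ∀ n : ℕ, n * w ≤ |y n|) :
    ∑' n : ℕ, ENNReal.ofReal (1 / (1 + y n ^ 2)) ≤ ENNReal.ofReal (1 + 2 / w) := by
  refine ENNReal.tsum_le_of_sum_range_le fun m => ?_
  rw [← ENNReal.ofReal_sum_of_nonneg (fun _ _ => by positivity)]
  refine ENNReal.ofReal_le_ofReal (le_trans (Finset.sum_le_sum fun n _ => ?_)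
    (sum_inv_one_add_sq_le hw m))
  rw [← sq_abs (y n)]
  gcongr
  exact hy n

/-- A shift of `j` absorbs the integer part of `x / w` and leaves an offset in `[0, w)`. Then each
half of `ℤ` is compared with the multiples of `w`. -/
theorem tsum_inv_one_add_sq_int_le {w : ℝ} (hw : w ≠ 0) (x : ℝ) :
    ∑' j : ℤ, ENNReal.ofReal (1 / (1 + (x + j * w) ^ 2)) ≤ ENNReal.ofReal (2 + 4 / |w|) := by
  wlog h : 0 < w generalizing w
  · have := this (w := -w) (by simpa) (by
      have := lt_of_le_of_ne (not_lt.1 h) hw; linarith)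
    rw [abs_neg] at this
    rw [← (Equiv.neg ℤ).tsum_eq]
    simpa using this
  have hx : x = ⌊x / w⌋ * w + Int.fract (x / w) * w := by
    rw [← add_mul, Int.floor_add_fract, div_mul_cancel₀ _ hw]
  set y := Int.fract (x / w) * w
  have hy0 : 0 ≤ y := mul_nonneg (Int.fract_nonneg _) h.le
  have hyw : y ≤ w := mul_le_of_le_one_left h.le (Int.fract_lt_one _).le
  rw [← (Equiv.subRight ⌊x / w⌋).tsum_eq]
  have e : ∀ j : ℤ, x + ((Equiv.subRight ⌊x / w⌋ j : ℤ) : ℝ) * w = y + j * w := by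
    intro j
    simp only [Equiv.subRight_apply, Int.cast_sub]
    linarith
  simp only [e]
  rw [tsum_int_eq, abs_of_pos h, show 2 + 4 / w = (1 + 2 / w) + (1 + 2 / w) by ring,
    ENNReal.ofReal_add (by positivity) (by positivity)]
  gcongr
  · refine tsum_inv_one_add_sq_nat_le h fun n => ?_
    push_cast
    exact le_trans (by linarith) (le_abs_self _)
  · refine tsum_inv_one_add_sq_nat_le h fun n => ?_
    push_cast
    exact le_trans (by linarith) (neg_le_abs _)

theorem tsum_geometric_ofReal : ∑' n : ℕ, ENNReal.ofReal ((1 / 2) ^ n) = 2 := by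
  rw [← ENNReal.ofReal_tsum_of_nonneg (fun n => by positivity) summable_geometric_two,
    tsum_geometric_two, ENNReal.ofReal_ofNat]

/-- A shift of `k` brings `ω` into `[1, 2]`. The function `t / (1 + t ^ 2)` is at most `1 / t` and
at most `t`, so both halves of the sum are dominated by geometric series of sum `2`. -/
theorem tsum_dyadic_le {ω : ℝ} (hω : 0 < ω) :
    ∑' k : ℤ, ENNReal.ofReal ((2 : ℝ) ^ k * ω / (1 + ((2 : ℝ) ^ k * ω) ^ 2)) ≤ 4 := by
  obtain ⟨m, hm1, hm2⟩ := exists_mem_Ico_zpow hω (one_lt_two : (1 : ℝ) < 2)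
  rw [← (Equiv.subRight m).tsum_eq]
  set v := ω / 2 ^ m with hv
  have h2m : (0 : ℝ) < 2 ^ m := by positivity
  have hv1 : 1 ≤ v := by rw [hv, le_div_iff₀ h2m]; linarith
  have hv2 : v ≤ 2 := by
    rw [hv, div_le_iff₀ h2m]; rw [zpow_add₀ two_ne_zero] at hm2; linarith
  have e : ∀ k : ℤ, (2 : ℝ) ^ (Equiv.subRight m k : ℤ) * ω = 2 ^ k * v := by
    intro k
    simp only [Equiv.subRight_apply, zpow_sub₀ (two_ne_zero : (2 : ℝ) ≠ 0), hv]
    ring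
  simp only [e]
  rw [tsum_int_eq, show (4 : ℝ≥0∞) = 2 + 2 by norm_num]
  rw [← tsum_geometric_ofReal]
  gcongr with n n
  · rw [zpow_natCast, div_le_iff₀ (by positivity), one_div, inv_pow, inv_mul_eq_div,
      le_div_iff₀ (by positivity)]
    have : (0 : ℝ) < 2 ^ n := by positivity
    nlinarith [mul_le_mul_of_nonneg_left hv1 this.le, mul_pos this this]
  · rw [zpow_neg, div_le_iff₀ (by positivity)]
    have h : (2 : ℝ) ^ ((n : ℤ) + 1) = 2 ^ n * 2 := by
      rw [zpow_add₀ two_ne_zero]; norm_cast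
    rw [h, one_div, inv_pow]
    have h3 : ((2 : ℝ) ^ n * 2)⁻¹ * v ≤ (2 ^ n)⁻¹ := by
      rw [mul_inv, mul_assoc]
      exact mul_le_of_le_one_right (by positivity) (by linarith)
    refine h3.trans (le_mul_of_one_le_right (by positivity) ?_)
    nlinarith [sq_nonneg (((2 : ℝ) ^ n * 2)⁻¹ * v)]

/-- The linear map with columns `a (1, s)` and `b (0, 1)`. -/
def shearMap (a b s : ℝ) (w : Plane) : Plane := !₂[a * w 0, s * a * w 0 + b * w 1]

/-- The transpose of `shearMap`. -/
def shearMapT (a b s : ℝ) (ξ : Plane) : Plane := !₂[a * (ξ 0 + s * ξ 1), b * ξ 1]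

theorem inner_shearMap (a b s : ℝ) (w ξ : Plane) :
    inner ℝ (shearMap a b s w) ξ = inner ℝ w (shearMapT a b s ξ) := by
  simp [shearMap, shearMapT, PiLp.inner_apply, Fin.sum_univ_two]
  ring

theorem measurable_shearMap (a b s : ℝ) : Measurable (shearMap a b s) := by
  have : Continuous (shearMap a b s) := by
    unfold shearMap
    refine (PiLp.continuous_toLp 2 _).comp (continuous_pi fun i => ?_)
    fin_cases i <;> simp <;> fun_prop
  exact this.measurable

theorem norm_shearMapT_sq (a b s : ℝ) (ξ : Plane) :
    ‖shearMapT a b s ξ‖ ^ 2 = (a * (ξ 0 + s * ξ 1)) ^ 2 + (b * ξ 1) ^ 2 := by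
  simp [shearMapT, EuclideanSpace.norm_sq_eq, Fin.sum_univ_two]

/-- The dyadic parallelogram shape of length `2 ^ k`, eccentricity `2 ^ l` and slope `j / 2 ^ l`. -/
def dyadicShear (l : ℕ) (j k : ℤ) : Plane → Plane :=
  shearMap (2 ^ k) (2 ^ k / 2 ^ l) (j / 2 ^ l)

/-- The Fourier multiplier of the Gaussian averages over a dyadic parallelogram. -/
def dyadicMult (l : ℕ) (j k : ℤ) (ξ : Plane) : ℝ :=
  Real.exp (-Real.pi * ‖shearMapT (2 ^ k) (2 ^ k / 2 ^ l) (j / 2 ^ l) ξ‖ ^ 2)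

/-- Writing `j = 2 * (j / 2) + j % 2` with `j % 2 ∈ {0, 1}`, the first coordinates for child and
parent differ by `0` or `w`, while the second ones are `w` and `2 * w`. -/
theorem dyadicMult_sub_sq_le (l : ℕ) (j k : ℤ) (ξ : Plane) :
    (dyadicMult (l + 1) j k ξ - dyadicMult l (j / 2) k ξ) ^ 2 ≤
      51200 * (2 ^ k * ξ 1 / 2 ^ (l + 1)) ^ 2 /
        ((1 + (2 ^ k * ξ 0 + j * (2 ^ k * ξ 1 / 2 ^ (l + 1))) ^ 2) *
          (1 + (2 ^ k * ξ 1 / 2 ^ (l + 1)) ^ 2) ^ 2) := by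
  set w : ℝ := 2 ^ k * ξ 1 / 2 ^ (l + 1) with hw
  have h1 : dyadicMult (l + 1) j k ξ =
      Real.exp (-Real.pi * ((2 ^ k * ξ 0 + j * w) ^ 2 + w ^ 2)) := by
    rw [dyadicMult, norm_shearMapT_sq, hw]
    congr 3 <;> ring
  have h2 : dyadicMult l (j / 2) k ξ =
      Real.exp (-Real.pi * ((2 ^ k * ξ 0 + (2 * (j / 2) : ℤ) * w) ^ 2 + 4 * w ^ 2)) := by
    rw [dyadicMult, norm_shearMapT_sq, hw]
    push_cast
    congr 3 <;> (field_simp; ring)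
  rw [h1, h2]
  refine sq_exp_sub_exp_le ?_
  have h3 : (2 : ℝ) ^ k * ξ 0 + j * w - (2 ^ k * ξ 0 + (2 * (j / 2) : ℤ) * w) =
      ((j % 2 : ℤ) : ℝ) * w := by
    rw [← sub_eq_iff_eq_add'.2 (Int.emod_add_mul_ediv j 2).symm]
    push_cast; ring
  rw [h3, abs_mul]
  refine mul_le_of_le_one_left (abs_nonneg _) ?_
  rcases Int.emod_two_eq_zero_or_one j with h | h <;> simp [h]

/-- The sum over slopes runs through points of spacing `|w|` and costs `2 + 4 / |w|`. Against `w ^ 2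
/ (1 + w ^ 2) ^ 2` this leaves a multiple of `|w| / (1 + w ^ 2)`, which is summable over dyadic
scales. The eccentricity enters only through the scaling `|ξ 1| / 2 ^ (l + 1)`, which the bound on
the dyadic sum does not see; hence the uniformity in `l`. -/
theorem tsum_dyadicMult_sub_sq_le (l : ℕ) (ξ : Plane) :
    ∑' k : ℤ, ∑' j : ℤ,
      ENNReal.ofReal ((dyadicMult (l + 1) j k ξ - dyadicMult l (j / 2) k ξ) ^ 2) ≤ 1638400 := by
  rcases eq_or_ne (ξ 1) 0 with h0 | h0
  · have : ∀ k j : ℤ, ENNReal.ofReal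
        ((dyadicMult (l + 1) j k ξ - dyadicMult l (j / 2) k ξ) ^ 2) = 0 := fun k j => by
      have := dyadicMult_sub_sq_le l j k ξ
      simp only [h0, mul_zero, zero_div, ne_eq, OfNat.ofNat_ne_zero, not_false_eq_true,
        zero_pow] at this
      exact ENNReal.ofReal_eq_zero.2 this
    simp [this]
  have hj : ∀ k : ℤ, ∑' j : ℤ,
      ENNReal.ofReal ((dyadicMult (l + 1) j k ξ - dyadicMult l (j / 2) k ξ) ^ 2) ≤
      409600 * ENNReal.ofReal (2 ^ k * (|ξ 1| / 2 ^ (l + 1)) /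
        (1 + (2 ^ k * (|ξ 1| / 2 ^ (l + 1))) ^ 2)) := by
    intro k
    set w : ℝ := 2 ^ k * ξ 1 / 2 ^ (l + 1) with hw
    have hw0 : w ≠ 0 := by positivity
    have hwa : (2 : ℝ) ^ k * (|ξ 1| / 2 ^ (l + 1)) = |w| := by
      rw [hw, abs_div, abs_mul, abs_of_pos (by positivity : (0 : ℝ) < 2 ^ k),
        abs_of_pos (by positivity : (0 : ℝ) < 2 ^ (l + 1))]
      ring
    rw [hwa]
    calc _ ≤ ∑' j : ℤ, ENNReal.ofReal (51200 * w ^ 2 / (1 + w ^ 2) ^ 2) *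
          ENNReal.ofReal (1 / (1 + (2 ^ k * ξ 0 + j * w) ^ 2)) := by
          refine ENNReal.tsum_le_tsum fun j => ?_
          rw [← ENNReal.ofReal_mul (by positivity)]
          refine ENNReal.ofReal_le_ofReal ((dyadicMult_sub_sq_le l j k ξ).trans_eq ?_)
          rw [← hw]
          field_simp
      _ ≤ ENNReal.ofReal (51200 * w ^ 2 / (1 + w ^ 2) ^ 2) * ENNReal.ofReal (2 + 4 / |w|) := by
          rw [ENNReal.tsum_mul_left]
          gcongr
          exact tsum_inv_one_add_sq_int_le hw0 _
      _ ≤ ENNReal.ofReal (409600 * (|w| / (1 + |w| ^ 2))) := by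
          rw [← ENNReal.ofReal_mul (by positivity)]
          refine ENNReal.ofReal_le_ofReal ?_
          have hw1 : 0 < |w| := abs_pos.2 hw0
          rw [← sq_abs w]
          have e : 51200 * |w| ^ 2 / (1 + |w| ^ 2) ^ 2 * (2 + 4 / |w|) =
              102400 * (|w| ^ 2 + 2 * |w|) / (1 + |w| ^ 2) ^ 2 := by
            field_simp; ring
          rw [e, ← mul_div_assoc, div_le_div_iff₀ (by positivity) (by positivity)]
          have : |w| ^ 2 + 2 * |w| ≤ 4 * |w| * (1 + |w| ^ 2) := by
            nlinarith [mul_nonneg hw1.le (sq_nonneg (|w| - 1)), pow_pos hw1 3, pow_pos hw1 2]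
          nlinarith [mul_le_mul_of_nonneg_right this (by positivity : 0 ≤ 1 + |w| ^ 2)]
      _ = _ := by
          rw [ENNReal.ofReal_mul (by norm_num)]; norm_num
  calc _ ≤ ∑' k : ℤ, 409600 * ENNReal.ofReal (2 ^ k * (|ξ 1| / 2 ^ (l + 1)) /
        (1 + (2 ^ k * (|ξ 1| / 2 ^ (l + 1))) ^ 2)) := ENNReal.tsum_le_tsum hj
    _ ≤ 409600 * 4 := by
        rw [ENNReal.tsum_mul_left]
        gcongr
        exact tsum_dyadic_le (by positivity)
    _ = _ := by norm_num

open FourierTransform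

/-- The square function of the differences between consecutive eccentricities is bounded on `L²`,
uniformly in the eccentricity. -/
theorem tsum_lintegral_gaussAvgC_sub_sq_le {g : Plane → ℂ} (hg : Measurable g)
    (h1 : Integrable g) (h2 : MemLp g 2) (l : ℕ) :
    ∑' k : ℤ, ∑' j : ℤ, ∫⁻ x, ‖gaussAvgC (dyadicShear (l + 1) j k) g x -
      gaussAvgC (dyadicShear l (j / 2) k) g x‖ₑ ^ 2 ≤ 1638400 * ∫⁻ x, ‖g x‖ₑ ^ 2 := by
  have hm : ∀ l j k, Measurable (dyadicShear l j k) := fun l j k => measurable_shearMap _ _ _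
  have hf : ∀ l j k ξ, 𝓕 (gaussAvgC (dyadicShear l j k) g) ξ =
      𝓕 g ξ * (dyadicMult l j k ξ : ℂ) := fun l j k ξ =>
    fourier_gaussAvgC (hm l j k) (inner_shearMap _ _ _) hg h1 ξ
  have hcont : Continuous (𝓕 g) :=
    VectorFourier.fourierIntegral_continuous Real.continuous_fourierChar
      (by exact continuous_inner) h1
  have hmm : ∀ l j k, Measurable (dyadicMult l j k) := fun l j k => by
    unfold dyadicMult
    simp only [norm_shearMapT_sq]
    fun_prop
  have key : ∀ k j : ℤ, ∫⁻ x, ‖gaussAvgC (dyadicShear (l + 1) j k) g x -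
      gaussAvgC (dyadicShear l (j / 2) k) g x‖ₑ ^ 2 =
      ∫⁻ ξ, ‖𝓕 g ξ‖ₑ ^ 2 * ENNReal.ofReal
        ((dyadicMult (l + 1) j k ξ - dyadicMult l (j / 2) k ξ) ^ 2) := by
    intro k j
    have i1 := integrable_gaussAvgC (hm (l + 1) j k) hg h1
    have i2 := integrable_gaussAvgC (hm l (j / 2) k) hg h1
    have m1 := memLp_gaussAvgC (hm (l + 1) j k) hg h1 h2
    have m2 := memLp_gaussAvgC (hm l (j / 2) k) hg h1 h2
    have := lintegral_enorm_fourier_sq (i1.sub i2) (m1.sub m2)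
    simp only [Pi.sub_apply] at this
    rw [← this]
    refine lintegral_congr fun ξ => ?_
    have e : 𝓕 (gaussAvgC (dyadicShear (l + 1) j k) g - gaussAvgC (dyadicShear l (j / 2) k) g) ξ =
        𝓕 g ξ * ((dyadicMult (l + 1) j k ξ - dyadicMult l (j / 2) k ξ : ℝ) : ℂ) := by
      rw [Real.fourier_eq]
      simp only [Pi.sub_apply, smul_sub]
      rw [integral_sub ((Real.fourierIntegral_convergent_iff ξ).2 i1)
        ((Real.fourierIntegral_convergent_iff ξ).2 i2), ← Real.fourier_eq, ← Real.fourier_eq,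
        hf, hf]
      push_cast
      ring
    rw [e, enorm_mul, mul_pow]
    congr 1
    rw [← sq_abs, ENNReal.ofReal_pow (abs_nonneg _)]
    congr 1
    rw [← ofReal_norm, Complex.norm_real, Real.norm_eq_abs]
  simp only [key]
  have hmeas : ∀ k j : ℤ, Measurable fun ξ => ‖𝓕 g ξ‖ₑ ^ 2 * ENNReal.ofReal
        ((dyadicMult (l + 1) j k ξ - dyadicMult l (j / 2) k ξ) ^ 2) := fun k j => by
    have := hmm (l + 1) j k
    have := hmm l (j / 2) k
    have := hcont.measurable
    fun_prop
  -- With the sums moved inside the integral, the claim becomes the pointwise bound on the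
  -- multipliers.
  simp_rw [← lintegral_tsum fun j => (hmeas _ j).aemeasurable]
  rw [← lintegral_tsum fun k => (Measurable.tsum (hmeas k)).aemeasurable,
    ← lintegral_enorm_fourier_sq h1 h2, ← lintegral_const_mul _ (hcont.enorm.measurable.pow_const 2)]
  refine lintegral_mono fun ξ => ?_
  simp only [ENNReal.tsum_mul_left]
  rw [mul_comm]
  gcongr
  exact tsum_dyadicMult_sub_sq_le l ξ

end SquareFunction

/-! ### The Hardy–Littlewood maximal function and eccentricity one -/

section MaximalFunction

/-- `shearMap` as a linear map. -/
def shearLin (a b s : ℝ) : Plane →ₗ[ℝ] Plane :=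
  Matrix.toLin (EuclideanSpace.basisFun (Fin 2) ℝ).toBasis (EuclideanSpace.basisFun (Fin 2) ℝ).toBasis
    !![a, 0; s * a, b]

theorem det_shearLin (a b s : ℝ) : LinearMap.det (shearLin a b s) = a * b := by
  rw [shearLin, LinearMap.det_toLin, Matrix.det_fin_two_of]
  ring

theorem shearLin_apply (a b s : ℝ) (w : Plane) : shearLin a b s w = shearMap a b s w := by
  ext i
  fin_cases i <;>
    simp [shearLin, shearMap, Matrix.toLin_apply, Fin.sum_univ_two, Matrix.mulVec, dotProduct]

theorem lintegral_shearMap {a b : ℝ} (ha : 0 < a) (hb : 0 < b) (s : ℝ) {f : Plane → ℝ≥0∞}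
    (hf : Measurable f) :
    ∫⁻ w, f (shearMap a b s w) = (ENNReal.ofReal (a * b))⁻¹ * ∫⁻ w, f w := by
  have h := Measure.map_linearMap_addHaar_eq_smul_addHaar (volume : Measure Plane)
    (f := shearLin a b s) (by rw [det_shearLin]; positivity)
  rw [det_shearLin] at h
  have e : ⇑(shearLin a b s) = shearMap a b s := funext (shearLin_apply a b s)
  rw [e] at h
  rw [← lintegral_map hf (measurable_shearMap a b s), h, lintegral_smul_measure,
    abs_of_pos (by positivity), ENNReal.ofReal_inv_of_pos (by positivity), smul_eq_mul]

/-- The centred Hardy–Littlewood maximal function. -/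
def hlMax (g : Plane → ℝ≥0∞) (x : Plane) : ℝ≥0∞ :=
  ⨆ (r : ℝ) (_ : 0 < r), (∫⁻ y in Metric.closedBall x r, g y) / volume (Metric.closedBall x r)

theorem volume_closedBall_pos (x : Plane) {r : ℝ} (hr : 0 < r) :
    volume (Metric.closedBall x r) ≠ 0 := (Metric.measure_closedBall_pos _ x hr).ne'

theorem lintegral_closedBall_le_hlMax (g : Plane → ℝ≥0∞) (x : Plane) {r : ℝ} (hr : 0 < r) :
    ∫⁻ y in Metric.closedBall x r, g y ≤ volume (Metric.closedBall x r) * hlMax g x := by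
  have h : (∫⁻ y in Metric.closedBall x r, g y) / volume (Metric.closedBall x r) ≤ hlMax g x :=
    le_iSup₂ (f := fun (r : ℝ) (_ : 0 < r) =>
      (∫⁻ y in Metric.closedBall x r, g y) / volume (Metric.closedBall x r)) r hr
  rw [mul_comm]
  exact (ENNReal.div_le_iff (volume_closedBall_pos x hr) measure_closedBall_lt_top.ne).1 h

theorem volume_closedBall_mul (x : Plane) {c r : ℝ} (hc : 0 < c) (hr : 0 ≤ r) :
    volume (Metric.closedBall x (c * r)) =
      ENNReal.ofReal (c ^ 2) * volume (Metric.closedBall x r) := by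
  rw [Measure.addHaar_closedBall_mul _ _ hc.le hr, Measure.addHaar_closedBall_center _ x r]
  simp

/-- The weak type `(1, 1)` inequality. -/
theorem volume_lt_hlMax_le {g : Plane → ℝ≥0∞} {t : ℝ≥0∞} (ht : 0 < t) (htop : t ≠ ∞) :
    volume {x | t < hlMax g x} ≤ 16 * (∫⁻ x, g x) / t := by
  rcases eq_or_ne (∫⁻ x, g x) ∞ with hI | hI
  · rw [hI]; simp [ENNReal.mul_top, ENNReal.top_div, htop]
  set s := {x | t < hlMax g x} with hs
  have hex : ∀ x : Plane, ∃ r : ℝ, x ∈ s → 0 < r ∧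
      t * volume (Metric.closedBall x r) < ∫⁻ y in Metric.closedBall x r, g y := by
    intro x
    by_cases hx : x ∈ s
    · simp only [hs, Set.mem_ofPred_eq, hlMax, lt_iSup_iff] at hx
      obtain ⟨r, hr, h⟩ := hx
      refine ⟨r, fun _ => ⟨hr, ?_⟩⟩
      exact (ENNReal.lt_div_iff_mul_lt (Or.inl (volume_closedBall_pos x hr))
        (Or.inl measure_closedBall_lt_top.ne)).1 h
    · exact ⟨0, fun h => absurd h hx⟩
  choose r hr using hex
  have hvol : ∀ x ∈ s, volume (Metric.closedBall x (r x)) ≤ (∫⁻ x, g x) / t := by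
    intro x hx
    rw [ENNReal.le_div_iff_mul_le (Or.inl ht.ne') (Or.inl htop), mul_comm]
    exact (hr x hx).2.le.trans (setLIntegral_le_lintegral _ _)
  -- The covering lemma needs bounded radii: every selected ball has area at most `(∫ g) / t`.
  have hbdd : ∃ R : ℝ, ∀ x ∈ s, r x ≤ R := by
    set V := volume (Metric.closedBall (0 : Plane) 1)
    have hV : V ≠ 0 := volume_closedBall_pos 0 one_pos
    have hVt : V ≠ ∞ := measure_closedBall_lt_top.ne
    have hfin : (∫⁻ x, g x) / t / V ≠ ∞ := by
      simp [ENNReal.div_eq_top, hI, ht.ne', hV]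
    refine ⟨max 1 ((∫⁻ x, g x) / t / V).toReal, fun x hx => ?_⟩
    by_cases h1 : r x ≤ 1
    · exact le_max_of_le_left h1
    refine le_max_of_le_right ?_
    push Not at h1
    have h := hvol x hx
    have e := volume_closedBall_mul x (hr x hx).1 zero_le_one
    rw [mul_one, Measure.addHaar_closedBall_center _ x 1] at e
    rw [e, ← ENNReal.le_div_iff_mul_le (Or.inl hV) (Or.inl hVt)] at h
    have := (ENNReal.ofReal_le_iff_le_toReal hfin).1 h
    nlinarith
  obtain ⟨R, hR⟩ := hbdd
  -- Enlarging radii by `4` multiplies areas by `16`, the constant of the weak type bound.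
  obtain ⟨u, hus, hdisj, hcov⟩ := Vitali.exists_disjoint_subfamily_covering_enlargement_closedBall
    s (fun x => x) r R hR 4 (by norm_num)
  have hcount : u.Countable := hdisj.countable_of_nonempty_interior fun x hx => by
    rw [interior_closedBall _ (hr x (hus hx)).1.ne']
    exact Metric.nonempty_ball.2 (hr x (hus hx)).1
  have hsub : s ⊆ ⋃ b ∈ u, Metric.closedBall b (4 * r b) := by
    intro x hx
    obtain ⟨b, hb, h⟩ := hcov x hx
    exact Set.mem_biUnion hb (h (Metric.mem_closedBall_self (hr x hx).1.le))
  have := hcount.to_subtype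
  calc volume s ≤ volume (⋃ b ∈ u, Metric.closedBall b (4 * r b)) := measure_mono hsub
    _ ≤ ∑' b : u, volume (Metric.closedBall (b : Plane) (4 * r b)) := measure_biUnion_le _ hcount _
    _ ≤ ∑' b : u, 16 * ((∫⁻ y in Metric.closedBall (b : Plane) (r b), g y) / t) := by
        refine ENNReal.tsum_le_tsum fun b => ?_
        have hb := hr b (hus b.2)
        rw [volume_closedBall_mul _ (by norm_num) hb.1.le]
        rw [show ENNReal.ofReal ((4 : ℝ) ^ 2) = 16 by norm_num]
        gcongr
        rw [ENNReal.le_div_iff_mul_le (Or.inl ht.ne') (Or.inl htop), mul_comm]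
        exact hb.2.le
    _ = 16 * (∑' b : u, ∫⁻ y in Metric.closedBall (b : Plane) (r b), g y) / t := by
        simp only [div_eq_mul_inv, ENNReal.tsum_mul_left, ENNReal.tsum_mul_right, mul_assoc]
    _ ≤ 16 * (∫⁻ x, g x) / t := by
        gcongr
        rw [← lintegral_biUnion hcount (fun b _ => measurableSet_closedBall) hdisj]
        exact setLIntegral_le_lintegral _ _

/-- The values of `g` not exceeding `t` contribute at most `t` to any average. This is the splitting
behind interpolation between weak `L¹` and `L^∞`. -/
theorem hlMax_le_add {g : Plane → ℝ≥0∞} (hg : Measurable g) (t : ℝ≥0∞) (x : Plane) :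
    hlMax g x ≤ t + hlMax ({y | t < g y}.indicator g) x := by
  refine iSup₂_le fun r hr => ?_
  rw [ENNReal.div_le_iff (volume_closedBall_pos x hr) measure_closedBall_lt_top.ne, add_mul]
  have h := lintegral_closedBall_le_hlMax ({y | t < g y}.indicator g) x hr
  rw [mul_comm] at h
  have hm : MeasurableSet {y | t < g y} := measurableSet_lt measurable_const hg
  calc ∫⁻ y in Metric.closedBall x r, g y
      ≤ ∫⁻ y in Metric.closedBall x r, (t + {y | t < g y}.indicator g y) := by
        refine lintegral_mono fun y => ?_
        by_cases hy : t < g y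
        · rw [Set.indicator_of_mem (show y ∈ {y | t < g y} from hy)]
          exact le_add_self
        · exact (not_lt.1 hy).trans le_self_add
    _ ≤ _ := by
        rw [lintegral_add_left measurable_const, setLIntegral_const]
        gcongr

theorem volume_lt_le_of_le_hlMax {F g : Plane → ℝ≥0∞} (hg : Measurable g)
    (hFg : ∀ x, F x ≤ hlMax g x) {t : ℝ} (ht : 0 < t) :
    volume {x | ENNReal.ofReal t < F x} ≤
      32 * (∫⁻ x in {y | ENNReal.ofReal (t / 2) < g y}, g x) / ENNReal.ofReal t := by
  set c := ENNReal.ofReal (t / 2) with hc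
  have hcc : ENNReal.ofReal t = c * 2 := by
    rw [hc, ← ENNReal.ofReal_ofNat, ← ENNReal.ofReal_mul (by positivity)]; congr 1; ring
  have hc0 : 0 < c := ENNReal.ofReal_pos.2 (by positivity)
  have hm : MeasurableSet {y | c < g y} := measurableSet_lt measurable_const hg
  have h := volume_lt_hlMax_le (g := {y | c < g y}.indicator g) hc0 ENNReal.ofReal_ne_top
  rw [lintegral_indicator hm] at h
  have e : 32 * (∫⁻ x in {y | c < g y}, g x) / ENNReal.ofReal t =
      16 * (∫⁻ x in {y | c < g y}, g x) / c := by
    rw [hcc, show (32 : ℝ≥0∞) = 16 * 2 by norm_num, mul_right_comm,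
      ENNReal.mul_div_mul_right _ _ (by norm_num) (by norm_num)]
  rw [e]
  refine le_trans (measure_mono fun x hx => ?_) h
  simp only [Set.mem_ofPred_eq] at hx ⊢
  have h2 := hx.trans_le ((hFg x).trans (hlMax_le_add hg c x))
  rw [hcc, mul_two] at h2
  exact lt_of_add_lt_add_left h2

/-- The `L²` bound for measurable functions dominated by the maximal function. -/
theorem lintegral_sq_le_of_le_hlMax {F g : Plane → ℝ≥0∞} (hF : Measurable F) (hg : Measurable g)
    (hFt : ∀ x, F x ≠ ∞) (hFg : ∀ x, F x ≤ hlMax g x) :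
    ∫⁻ x, F x ^ 2 ≤ 128 * ∫⁻ x, g x ^ 2 := by
  -- Marcinkiewicz interpolation in layer cake form. After Tonelli the inner integral over `0 < t`
  -- with `t / 2 < g x` contributes `2 * g x`, and `2 * 32 * 2 = 128`.
  have h := lintegral_rpow_eq_lintegral_meas_lt_mul (volume : Measure Plane)
    (f := fun x => (F x).toReal) (ae_of_all _ fun _ => ENNReal.toReal_nonneg)
    hF.ennreal_toReal.aemeasurable (p := 2) (by norm_num)
  have e1 : ∀ x, ENNReal.ofReal ((F x).toReal ^ (2 : ℝ)) = F x ^ 2 := fun x => by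
    rw [Real.rpow_two, ENNReal.ofReal_pow ENNReal.toReal_nonneg, ENNReal.ofReal_toReal (hFt x)]
  simp only [e1] at h
  rw [h, ENNReal.ofReal_ofNat]
  have hmeas : Measurable fun q : ℝ × Plane =>
      {q : ℝ × Plane | ENNReal.ofReal (q.1 / 2) < g q.2}.indicator (fun q => g q.2) q := by
    refine Measurable.indicator (by fun_prop) (measurableSet_lt (by fun_prop) (by fun_prop))
  have h1 : ∀ t ∈ Set.Ioi (0 : ℝ), volume {x | t < (F x).toReal} * ENNReal.ofReal (t ^ ((2 : ℝ) - 1)) ≤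
      32 * ∫⁻ x, {q : ℝ × Plane | ENNReal.ofReal (q.1 / 2) < g q.2}.indicator
        (fun q => g q.2) (t, x) := by
    intro t ht
    have ht' : (0 : ℝ) < t := ht
    have e : {x | t < (F x).toReal} = {x | ENNReal.ofReal t < F x} := by
      ext x
      exact (ENNReal.ofReal_lt_iff_lt_toReal ht'.le (hFt x)).symm
    have h2 := volume_lt_le_of_le_hlMax hg hFg ht'
    rw [e, show (2 : ℝ) - 1 = 1 by norm_num, Real.rpow_one]
    rw [ENNReal.le_div_iff_mul_le (Or.inl (ENNReal.ofReal_pos.2 ht').ne')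
      (Or.inl ENNReal.ofReal_ne_top)] at h2
    refine h2.trans_eq ?_
    rw [← lintegral_indicator (measurableSet_lt measurable_const hg)]
    rfl
  calc _ ≤ 2 * ∫⁻ t in Set.Ioi (0 : ℝ), 32 * ∫⁻ x,
        {q : ℝ × Plane | ENNReal.ofReal (q.1 / 2) < g q.2}.indicator (fun q => g q.2) (t, x) := by
        gcongr 2 * ?_
        exact setLIntegral_mono' measurableSet_Ioi h1
    _ = 64 * ∫⁻ x, ∫⁻ t in Set.Ioi (0 : ℝ),
        {q : ℝ × Plane | ENNReal.ofReal (q.1 / 2) < g q.2}.indicator (fun q => g q.2) (t, x) := by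
        rw [lintegral_const_mul _ hmeas.lintegral_prod_right', ← mul_assoc,
          lintegral_lintegral_swap hmeas.aemeasurable]
        norm_num
    _ ≤ 64 * ∫⁻ x, 2 * g x ^ 2 := by
        gcongr with x
        have e : (fun t : ℝ => {q : ℝ × Plane | ENNReal.ofReal (q.1 / 2) < g q.2}.indicator
            (fun q => g q.2) (t, x)) =
            {t : ℝ | ENNReal.ofReal (t / 2) < g x}.indicator (fun _ => g x) := rfl
        rw [e, lintegral_indicator (measurableSet_lt (by fun_prop) measurable_const),
          setLIntegral_const, Measure.restrict_apply
            (measurableSet_lt (by fun_prop) measurable_const)]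
        rcases eq_or_ne (g x) ∞ with hx | hx
        · simp [hx]
        have hsub : {t : ℝ | ENNReal.ofReal (t / 2) < g x} ∩ Set.Ioi 0 ⊆
            Set.Ioc 0 (2 * (g x).toReal) := by
          rintro t ⟨ht1, ht2⟩
          refine ⟨ht2, ?_⟩
          have ht2' : (0 : ℝ) < t := ht2
          have := (ENNReal.ofReal_lt_iff_lt_toReal (by positivity) hx).1 ht1
          linarith
        calc g x * volume _ ≤ g x * volume (Set.Ioc 0 (2 * (g x).toReal)) := by gcongr
          _ = 2 * g x ^ 2 := by
            rw [Real.volume_Ioc, sub_zero, ENNReal.ofReal_mul (by norm_num),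
              ENNReal.ofReal_toReal hx, ENNReal.ofReal_ofNat]
            ring
    _ = _ := by
        rw [lintegral_const_mul _ (hg.pow_const 2), ← mul_assoc]; norm_num

theorem norm_dyadicShear_zero_le {j : ℤ} (hj : |j| ≤ 1) (k : ℤ) (w : Plane) :
    ‖dyadicShear 0 j k w‖ ≤ 2 * 2 ^ k * ‖w‖ := by
  have hk : (0 : ℝ) < 2 ^ k := by positivity
  refine abs_le_of_sq_le_sq' ?_ (by positivity) |>.2
  have hj' : (j : ℝ) ^ 2 ≤ 1 := by
    have : |(j : ℝ)| ≤ 1 := by exact_mod_cast hj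
    rw [← sq_abs]; nlinarith [abs_nonneg (j : ℝ)]
  rw [mul_pow, mul_pow, EuclideanSpace.norm_sq_eq, EuclideanSpace.norm_sq_eq]
  simp only [dyadicShear, shearMap, Fin.sum_univ_two, Real.norm_eq_abs, sq_abs, pow_zero, div_one]
  simp only [Matrix.cons_val_zero, Matrix.cons_val_one]
  have : ((j : ℝ) * w 0 + w 1) ^ 2 ≤ 2 * w 0 ^ 2 + 2 * w 1 ^ 2 := by
    nlinarith [sq_nonneg ((j : ℝ) * w 0 - w 1), mul_le_mul_of_nonneg_right hj' (sq_nonneg (w 0))]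
  have e : (2 ^ k * w 0) ^ 2 + ((j : ℝ) * 2 ^ k * w 0 + 2 ^ k * w 1) ^ 2 =
      (2 ^ k) ^ 2 * (w 0 ^ 2 + ((j : ℝ) * w 0 + w 1) ^ 2) := by ring
  rw [e, mul_comm ((2 : ℝ) ^ 2), mul_assoc]
  gcongr
  nlinarith [sq_nonneg (w 0), sq_nonneg (w 1)]

/-- Only the term `m = ⌊‖w‖⌋₊` is needed, since `π * m ^ 2 ≥ m` for a natural number `m`. -/
theorem gaussDensity_le_tsum (w : Plane) :
    ENNReal.ofReal (Real.exp (-Real.pi * ‖w‖ ^ 2)) ≤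
      ∑' m : ℕ, ENNReal.ofReal (Real.exp (-m)) *
        (Metric.closedBall (0 : Plane) (m + 1)).indicator 1 w := by
  refine le_trans ?_ (ENNReal.le_tsum ⌊‖w‖⌋₊)
  rw [Set.indicator_of_mem (by simpa using (Nat.lt_floor_add_one ‖w‖).le)]
  simp only [Pi.one_apply, mul_one]
  refine ENNReal.ofReal_le_ofReal (Real.exp_le_exp.2 ?_)
  have h1 := Nat.floor_le (norm_nonneg w)
  have hpi := Real.pi_gt_three
  rcases Nat.eq_zero_or_pos ⌊‖w‖⌋₊ with h | h
  · rw [h]; simp; positivity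
  · have : (1 : ℝ) ≤ ⌊‖w‖⌋₊ := by exact_mod_cast h
    nlinarith

/-- Gaussian averages of eccentricity one are dominated by the maximal function. -/
theorem exists_gaussAvg_le_hlMax : ∃ C : ℝ≥0∞, C ≠ ∞ ∧ ∀ (g : Plane → ℝ≥0∞), Measurable g →
    ∀ (j k : ℤ) (x : Plane), |j| ≤ 1 → gaussAvg (dyadicShear 0 j k) g x ≤ C * hlMax g x := by
  set V := volume (Metric.closedBall (0 : Plane) 1)
  refine ⟨∑' m : ℕ, ENNReal.ofReal (Real.exp (-m)) *
    (ENNReal.ofReal ((2 * (m + 1)) ^ 2) * V), ?_, ?_⟩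
  · simp_rw [← mul_assoc, ENNReal.tsum_mul_right,
      ← ENNReal.ofReal_mul (Real.exp_pos _).le]
    refine ENNReal.mul_ne_top ?_ measure_closedBall_lt_top.ne
    have hs : Summable fun m : ℕ => Real.exp (-m) * (2 * ((m : ℝ) + 1)) ^ 2 := by
      have h2 := Real.summable_pow_mul_exp_neg_nat_mul 2 one_pos
      have h1 := Real.summable_pow_mul_exp_neg_nat_mul 1 one_pos
      have h0 := Real.summable_pow_mul_exp_neg_nat_mul 0 one_pos
      refine (((h2.mul_left 4).add (h1.mul_left 8)).add (h0.mul_left 4)).congr fun m => ?_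
      simp only [neg_mul, one_mul]; ring
    rw [← ENNReal.ofReal_tsum_of_nonneg (fun m => by positivity) hs]
    exact ENNReal.ofReal_ne_top
  · intro g hg j k x hj
    have hB : Measurable (dyadicShear 0 j k) := measurable_shearMap _ _ _
    rw [gaussAvg, gaussMeasure, lintegral_withDensity_eq_lintegral_mul _
      (by fun_prop) (by fun_prop)]
    have hm : ∀ m : ℕ, Measurable fun w : Plane => ENNReal.ofReal (Real.exp (-m)) *
        (Metric.closedBall (0 : Plane) (m + 1)).indicator (1 : Plane → ℝ≥0∞) w :=
      fun m => (Measurable.indicator measurable_const measurableSet_closedBall).const_mul _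
    calc _ ≤ ∫⁻ w, ∑' m : ℕ, (ENNReal.ofReal (Real.exp (-m)) *
          (Metric.closedBall (0 : Plane) (m + 1)).indicator 1 w) * g (x - dyadicShear 0 j k w) := by
          refine lintegral_mono fun w => ?_
          simp only [Pi.mul_apply]
          rw [ENNReal.tsum_mul_right]
          gcongr
          exact gaussDensity_le_tsum w
      _ = ∑' m : ℕ, ∫⁻ w, (ENNReal.ofReal (Real.exp (-m)) *
          (Metric.closedBall (0 : Plane) (m + 1)).indicator 1 w) * g (x - dyadicShear 0 j k w) :=
          lintegral_tsum fun m => ((hm m).mul (by fun_prop)).aemeasurable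
      _ ≤ ∑' m : ℕ, (ENNReal.ofReal (Real.exp (-m)) *
          (ENNReal.ofReal ((2 * (m + 1)) ^ 2) * V)) * hlMax g x := by
          refine ENNReal.tsum_le_tsum fun m => ?_
          simp_rw [mul_assoc]
          rw [lintegral_const_mul' _ _ ENNReal.ofReal_ne_top]
          gcongr
          have hk : (0 : ℝ) < 2 ^ k := by positivity
          -- The disc of radius `m + 1` is mapped into the disc of radius `ρ`, and the determinant
          -- `2 ^ k * 2 ^ k` cancels the scale in the area of that disc.
          set ρ : ℝ := 2 ^ k * (2 * (m + 1)) with hρ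
          have hρ0 : 0 < ρ := by positivity
          set G : Plane → ℝ≥0∞ := fun z => (Metric.closedBall x ρ).indicator g (x - z) with hG
          have hGm : Measurable G :=
            (hg.indicator measurableSet_closedBall).comp (by fun_prop)
          calc _ ≤ ∫⁻ w, G (dyadicShear 0 j k w) := by
                refine lintegral_mono fun w => ?_
                by_cases hw : w ∈ Metric.closedBall (0 : Plane) (m + 1)
                · rw [Set.indicator_of_mem hw, hG]
                  simp only [Pi.one_apply, one_mul]
                  rw [Set.indicator_of_mem]
                  rw [mem_closedBall_iff_norm, sub_sub_cancel_left, norm_neg]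
                  refine (norm_dyadicShear_zero_le hj k w).trans ?_
                  rw [mem_closedBall_zero_iff] at hw
                  rw [hρ]
                  nlinarith
                · rw [Set.indicator_of_notMem hw]; simp
            _ = (ENNReal.ofReal (2 ^ k * 2 ^ k))⁻¹ * ∫⁻ y in Metric.closedBall x ρ, g y := by
                have := lintegral_shearMap hk (by positivity : (0 : ℝ) < 2 ^ k / 2 ^ 0)
                  ((j : ℝ) / 2 ^ 0) hGm
                rw [dyadicShear, this, hG,
                  lintegral_sub_left_eq_self (fun z => (Metric.closedBall x ρ).indicator g z) x,
                  lintegral_indicator measurableSet_closedBall]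
                simp
            _ ≤ (ENNReal.ofReal (2 ^ k * 2 ^ k))⁻¹ *
                (volume (Metric.closedBall x ρ) * hlMax g x) := by
                gcongr
                exact lintegral_closedBall_le_hlMax g x hρ0
            _ = _ := by
                have e := volume_closedBall_mul x hρ0 zero_le_one
                rw [mul_one, Measure.addHaar_closedBall_center _ x 1] at e
                have e2 : ENNReal.ofReal (ρ ^ 2) = ENNReal.ofReal (2 ^ k * 2 ^ k) *
                    ENNReal.ofReal ((2 * (m + 1)) ^ 2) := by
                  rw [← ENNReal.ofReal_mul (by positivity), hρ]
                  congr 1; ring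
                rw [e, e2, ← mul_assoc, ← mul_assoc, ← mul_assoc, ENNReal.inv_mul_cancel
                    (ENNReal.ofReal_pos.2 (by positivity)).ne' ENNReal.ofReal_ne_top, one_mul,
                    mul_assoc]
      _ = _ := by rw [ENNReal.tsum_mul_right]

end MaximalFunction

/-! ### Telescoping over eccentricities -/

section Telescoping

/-- The maximal function of the Gaussian averages over the dyadic parallelograms of
eccentricity `2 ^ n` and slope at most one. -/
def dyadicMax (n : ℕ) (g : Plane → ℝ≥0∞) (x : Plane) : ℝ≥0∞ :=
  ⨆ (k : ℤ) (j : ℤ) (_ : |j| ≤ 2 ^ n), gaussAvg (dyadicShear n j k) g x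

theorem measurable_dyadicShear (l : ℕ) (j k : ℤ) : Measurable (dyadicShear l j k) :=
  measurable_shearMap _ _ _

theorem measurable_dyadicMax (n : ℕ) {g : Plane → ℝ≥0∞} (hg : Measurable g) :
    Measurable (dyadicMax n g) :=
  Measurable.iSup fun k => Measurable.iSup fun j => Measurable.iSup fun _ =>
    measurable_gaussAvg (measurable_dyadicShear n j k) hg

theorem gaussAvg_le_const {B : Plane → Plane} {g : Plane → ℝ≥0∞} {M : ℝ≥0∞}
    (h : ∀ x, g x ≤ M) (x : Plane) : gaussAvg B g x ≤ M :=
  (lintegral_mono fun w => h (x - B w)).trans_eq (by simp)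

/-- The `L²` bound for eccentricity one. -/
theorem exists_lintegral_dyadicMax_zero_sq_le : ∃ C : ℝ≥0∞, C ≠ ∞ ∧
    ∀ (g : Plane → ℝ≥0∞) (M : ℝ≥0), Measurable g → (∀ x, g x ≤ M) →
      ∫⁻ x, dyadicMax 0 g x ^ 2 ≤ C * ∫⁻ x, g x ^ 2 := by
  obtain ⟨C, hC, h⟩ := exists_gaussAvg_le_hlMax
  -- The constant `C` might vanish, so `C + 1` is the one that gets inverted.
  have hC0 : C + 1 ≠ 0 := by simp
  have hCt : C + 1 ≠ ∞ := by simp [hC]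
  refine ⟨(C + 1) ^ 2 * 128, ENNReal.mul_ne_top (ENNReal.pow_ne_top hCt) (by norm_num), ?_⟩
  intro g M hg hM
  have hle : ∀ x, dyadicMax 0 g x ≤ (C + 1) * hlMax g x := fun x =>
    iSup_le fun k => iSup₂_le fun j hj => (h g hg j k x (by simpa using hj)).trans
      (by gcongr; exact le_self_add)
  have hbd : ∀ x, dyadicMax 0 g x ≤ M := fun x =>
    iSup_le fun k => iSup₂_le fun j _ => gaussAvg_le_const hM x
  have key := lintegral_sq_le_of_le_hlMax (F := fun x => (C + 1)⁻¹ * dyadicMax 0 g x) (g := g)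
    ((measurable_dyadicMax 0 hg).const_mul _) hg
    (fun x => ENNReal.mul_ne_top (ENNReal.inv_ne_top.2 hC0)
      (ne_top_of_le_ne_top ENNReal.coe_ne_top (hbd x)))
    (fun x => by
      rw [mul_comm, ← div_eq_mul_inv]
      exact ENNReal.div_le_of_le_mul' (hle x))
  calc ∫⁻ x, dyadicMax 0 g x ^ 2
      = (C + 1) ^ 2 * ∫⁻ x, ((C + 1)⁻¹ * dyadicMax 0 g x) ^ 2 := by
        rw [← lintegral_const_mul' _ _ (ENNReal.pow_ne_top hCt)]
        refine lintegral_congr fun x => ?_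
        rw [← mul_pow, ← mul_assoc, ENNReal.mul_inv_cancel hC0 hCt, one_mul]
    _ ≤ _ := by rw [mul_assoc]; gcongr

theorem gaussAvgC_ofReal {B : Plane → Plane} (hB : Measurable B) {g : Plane → ℝ≥0}
    (hg : Measurable g) (x : Plane) :
    gaussAvgC B (fun y => ((g y : ℝ) : ℂ)) x =
      ((gaussAvg B (fun y => (g y : ℝ≥0∞)) x).toReal : ℂ) := by
  rw [gaussAvgC, integral_complex_ofReal, integral_eq_lintegral_of_nonneg_ae (ae_of_all _ fun _ => by simp)
    (by
      have : Measurable fun w => ((g (x - B w) : ℝ≥0) : ℝ) := by fun_prop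
      exact this.aestronglyMeasurable)]
  simp [gaussAvg]

/-- The square function of consecutive differences. -/
def dyadicSq (l : ℕ) (g : Plane → ℂ) (x : Plane) : ℝ≥0∞ :=
  ∑' k : ℤ, ∑' j : ℤ, ‖gaussAvgC (dyadicShear (l + 1) j k) g x -
      gaussAvgC (dyadicShear l (j / 2) k) g x‖ₑ ^ 2

/-- Each average is its parent plus a difference. The parent slope index `j / 2` is still admissible
at level `n`, and a single difference is at most the `ℓ²` sum of all of them. The bound on `g` makes
the averages finite, so that the complex and the extended nonnegative versions agree. -/
theorem dyadicMax_succ_le {g : Plane → ℝ≥0} (hg : Measurable g) {M : ℝ≥0} (hM : ∀ x, g x ≤ M)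
    (n : ℕ) (x : Plane) :
    dyadicMax (n + 1) (fun y => (g y : ℝ≥0∞)) x ≤ dyadicMax n (fun y => (g y : ℝ≥0∞)) x +
      dyadicSq n (fun y => ((g y : ℝ) : ℂ)) x ^ (1 / 2 : ℝ) := by
  refine iSup_le fun k => iSup₂_le fun j hj => ?_
  have he : ∀ l j, gaussAvg (dyadicShear l j k) (fun y => (g y : ℝ≥0∞)) x =
      ‖gaussAvgC (dyadicShear l j k) (fun y => ((g y : ℝ) : ℂ)) x‖ₑ := fun l j => by
    have hne : gaussAvg (dyadicShear l j k) (fun y => (g y : ℝ≥0∞)) x ≠ ∞ :=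
      ne_top_of_le_ne_top (ENNReal.coe_ne_top (r := M))
        (gaussAvg_le_const (fun x => by exact_mod_cast hM x) x)
    rw [gaussAvgC_ofReal (measurable_dyadicShear l j k) hg, ← ofReal_norm, Complex.norm_real,
      Real.norm_of_nonneg ENNReal.toReal_nonneg, ENNReal.ofReal_toReal hne]
  have h1 : gaussAvg (dyadicShear n (j / 2) k) (fun y => (g y : ℝ≥0∞)) x ≤
      dyadicMax n (fun y => (g y : ℝ≥0∞)) x := by
    have hj2 : |j / 2| ≤ 2 ^ n := by
      rw [pow_succ, abs_le] at hj
      rw [abs_le]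
      omega
    exact le_iSup_of_le k (le_iSup₂_of_le (j / 2) hj2 le_rfl)
  have h2 : ‖gaussAvgC (dyadicShear (n + 1) j k) (fun y => ((g y : ℝ) : ℂ)) x -
      gaussAvgC (dyadicShear n (j / 2) k) (fun y => ((g y : ℝ) : ℂ)) x‖ₑ ≤
      dyadicSq n (fun y => ((g y : ℝ) : ℂ)) x ^ (1 / 2 : ℝ) := by
    rw [← ENNReal.rpow_le_rpow_iff (z := 2) (by norm_num), ← ENNReal.rpow_mul]
    norm_num
    refine le_trans ?_ (ENNReal.le_tsum k)
    exact ENNReal.le_tsum (f := fun j => ‖gaussAvgC (dyadicShear (n + 1) j k) _ x -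
      gaussAvgC (dyadicShear n (j / 2) k) _ x‖ₑ ^ 2) j
  rw [he] at h1 ⊢
  refine le_trans ?_ (add_le_add h1 h2)
  refine le_trans (le_of_eq ?_) (enorm_add_le _ _)
  rw [add_sub_cancel]

/-- Iteration leaves `n + 1` summands, and Cauchy–Schwarz on them costs the factor `n + 1`. -/
theorem dyadicMax_sq_le {g : Plane → ℝ≥0} (hg : Measurable g) {M : ℝ≥0} (hM : ∀ x, g x ≤ M)
    (n : ℕ) (x : Plane) :
    dyadicMax n (fun y => (g y : ℝ≥0∞)) x ^ 2 ≤
      (n + 1) * (dyadicMax 0 (fun y => (g y : ℝ≥0∞)) x ^ 2 +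
        ∑ l ∈ Finset.range n, dyadicSq l (fun y => ((g y : ℝ) : ℂ)) x) := by
  set S := fun l => dyadicSq l (fun y => ((g y : ℝ) : ℂ)) x
  set A := fun l => dyadicMax l (fun y => (g y : ℝ≥0∞)) x
  have h1 : A n ≤ ∑ l ∈ Finset.range n, S l ^ (1 / 2 : ℝ) + A 0 := by
    induction n with
    | zero => simp
    | succ n ih =>
      rw [Finset.sum_range_succ, add_right_comm]
      refine (dyadicMax_succ_le hg hM n x).trans ?_
      gcongr
  set f : ℕ → ℝ≥0∞ := fun i => Nat.casesOn i (A 0) fun l => S l ^ (1 / 2 : ℝ)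
  have h2 := ENNReal.rpow_sum_le_const_mul_sum_rpow (Finset.range (n + 1)) f
    (p := 2) (by norm_num)
  rw [Finset.sum_range_succ', Finset.sum_range_succ'] at h2
  simp only [f, ← ENNReal.rpow_mul] at h2
  norm_num at h2
  calc A n ^ 2 ≤ (∑ l ∈ Finset.range n, S l ^ (1 / 2 : ℝ) + A 0) ^ 2 := by gcongr
    _ ≤ _ := by
        rw [add_comm (A 0 ^ 2)]
        convert h2 using 3

theorem measurable_gaussAvgC_ofReal {B : Plane → Plane} (hB : Measurable B) {g : Plane → ℝ≥0}
    (hg : Measurable g) : Measurable (gaussAvgC B (fun y => ((g y : ℝ) : ℂ))) := by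
  rw [funext (gaussAvgC_ofReal hB hg)]
  have := measurable_gaussAvg hB hg.coe_nnreal_ennreal
  fun_prop

/-- One factor `n + 1` comes from Cauchy–Schwarz, the other from adding the level-zero term and `n`
square functions with a common bound. Boundedness and integrability place `g` in `L¹ ∩ L²` for
Plancherel; truncation and monotone convergence remove them afterwards. -/
theorem exists_lintegral_dyadicMax_sq_le_of_bounded : ∃ C : ℝ≥0∞, C ≠ ∞ ∧
    ∀ (n : ℕ) (g : Plane → ℝ≥0) (M : ℝ≥0), Measurable g → (∀ x, g x ≤ M) →
      Integrable (fun x => ((g x : ℝ) : ℂ)) →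
      ∫⁻ x, dyadicMax n (fun y => (g y : ℝ≥0∞)) x ^ 2 ≤
        C * (n + 1) ^ 2 * ∫⁻ x, (g x : ℝ≥0∞) ^ 2 := by
  obtain ⟨C, hC, h0⟩ := exists_lintegral_dyadicMax_zero_sq_le
  refine ⟨C + 1638400, by simp [hC], ?_⟩
  intro n g M hg hM hI
  have hgC : Measurable fun x => ((g x : ℝ) : ℂ) := by fun_prop
  have h2 : MemLp (fun x => ((g x : ℝ) : ℂ)) 2 := by
    refine ⟨hgC.aestronglyMeasurable, ?_⟩
    rw [eLpNorm_lt_top_iff_lintegral_rpow_enorm_lt_top (by norm_num) (by norm_num)]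
    have hI2 := hI.2
    rw [hasFiniteIntegral_iff_enorm] at hI2
    refine lt_of_le_of_lt ?_ (ENNReal.mul_lt_top (ENNReal.coe_lt_top (r := M)) hI2)
    rw [← lintegral_const_mul' _ _ ENNReal.coe_ne_top]
    refine lintegral_mono fun x => ?_
    simp only [ENNReal.toReal_ofNat, ENNReal.rpow_ofNat]
    rw [sq, ← ofReal_norm, Complex.norm_real, NNReal.norm_eq, ENNReal.ofReal_coe_nnreal]
    gcongr
    exact hM x
  have hmS : ∀ l k j, Measurable fun x =>
      ‖gaussAvgC (dyadicShear (l + 1) j k) (fun y => ((g y : ℝ) : ℂ)) x -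
      gaussAvgC (dyadicShear l (j / 2) k) (fun y => ((g y : ℝ) : ℂ)) x‖ₑ ^ 2 := fun l k j => by
    have h1 := measurable_gaussAvgC_ofReal (measurable_dyadicShear (l + 1) j k) hg
    have h2 := measurable_gaussAvgC_ofReal (measurable_dyadicShear l (j / 2) k) hg
    exact (h1.sub h2).enorm.pow_const 2
  have hS : ∀ l, ∫⁻ x, dyadicSq l (fun y => ((g y : ℝ) : ℂ)) x ≤
      1638400 * ∫⁻ x, (g x : ℝ≥0∞) ^ 2 := fun l => by
    have := tsum_lintegral_gaussAvgC_sub_sq_le hgC hI h2 l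
    have e : ∀ x, ‖((g x : ℝ) : ℂ)‖ₑ = (g x : ℝ≥0∞) := fun x => by
      rw [← ofReal_norm, Complex.norm_real, NNReal.norm_eq, ENNReal.ofReal_coe_nnreal]
    simp only [e] at this
    refine le_trans (le_of_eq ?_) this
    unfold dyadicSq
    rw [lintegral_tsum fun k => (Measurable.tsum (hmS l k)).aemeasurable]
    congr 1; ext k
    rw [lintegral_tsum fun j => (hmS l k j).aemeasurable]
  have hmq : ∀ l, Measurable (dyadicSq l (fun y => ((g y : ℝ) : ℂ))) := fun l =>
    Measurable.tsum fun k => Measurable.tsum (hmS l k)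
  calc _ ≤ ∫⁻ x, (n + 1) * (dyadicMax 0 (fun y => (g y : ℝ≥0∞)) x ^ 2 +
        ∑ l ∈ Finset.range n, dyadicSq l (fun y => ((g y : ℝ) : ℂ)) x) :=
        lintegral_mono fun x => dyadicMax_sq_le hg hM n x
    _ = (n + 1) * ((∫⁻ x, dyadicMax 0 (fun y => (g y : ℝ≥0∞)) x ^ 2) +
        ∑ l ∈ Finset.range n, ∫⁻ x, dyadicSq l (fun y => ((g y : ℝ) : ℂ)) x) := by
        rw [lintegral_const_mul' _ _ (by finiteness),
          lintegral_add_right _ (Finset.measurable_fun_sum _ fun l _ => hmq l),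
          lintegral_finsetSum _ fun l _ => hmq l]
    _ ≤ (n + 1) * ((C * ∫⁻ x, (g x : ℝ≥0∞) ^ 2) +
        ∑ l ∈ Finset.range n, 1638400 * ∫⁻ x, (g x : ℝ≥0∞) ^ 2) := by
        gcongr
        · exact h0 _ M hg.coe_nnreal_ennreal (fun x => by exact_mod_cast hM x)
        · exact hS _
    _ = ((n + 1) * C + (n + 1) * n * 1638400) * ∫⁻ x, (g x : ℝ≥0∞) ^ 2 := by
        rw [Finset.sum_const, Finset.card_range, nsmul_eq_mul]; ring
    _ ≤ _ := by
        gcongr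
        calc (n + 1) * C + (n + 1) * n * 1638400
            ≤ ((n + 1) * (n + 1)) * C + (n + 1) * (n + 1) * (1638400 : ℝ≥0∞) := by
              gcongr
              · exact le_mul_of_one_le_right (by positivity) le_add_self
              · exact le_self_add
          _ = _ := by ring

/-- Bounded integrable truncations of a nonnegative function. -/
def truncate (g : Plane → ℝ≥0∞) (m : ℕ) (x : Plane) : ℝ≥0 :=
  (Metric.closedBall (0 : Plane) m).indicator (fun y => (min (g y) m).toNNReal) x

theorem measurable_truncate {g : Plane → ℝ≥0∞} (hg : Measurable g) (m : ℕ) :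
    Measurable (truncate g m) :=
  Measurable.indicator (by fun_prop) measurableSet_closedBall

theorem truncate_le (g : Plane → ℝ≥0∞) (m : ℕ) (x : Plane) : truncate g m x ≤ m := by
  unfold truncate
  by_cases hx : x ∈ Metric.closedBall (0 : Plane) m
  · rw [Set.indicator_of_mem hx]
    rw [← ENNReal.coe_le_coe, ENNReal.coe_toNNReal
      (ne_top_of_le_ne_top (ENNReal.natCast_ne_top m) (min_le_right _ _))]
    simp
  · rw [Set.indicator_of_notMem hx]; simp

theorem coe_truncate (g : Plane → ℝ≥0∞) (m : ℕ) (x : Plane) :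
    (truncate g m x : ℝ≥0∞) = (Metric.closedBall (0 : Plane) m).indicator
      (fun y => min (g y) m) x := by
  unfold truncate
  by_cases hx : x ∈ Metric.closedBall (0 : Plane) m
  · rw [Set.indicator_of_mem hx, Set.indicator_of_mem hx, ENNReal.coe_toNNReal]
    exact ne_top_of_le_ne_top (ENNReal.natCast_ne_top m) (min_le_right _ _)
  · rw [Set.indicator_of_notMem hx, Set.indicator_of_notMem hx]; simp

theorem monotone_coe_truncate (g : Plane → ℝ≥0∞) :
    Monotone fun m x => (truncate g m x : ℝ≥0∞) := by
  intro m m' h x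
  simp only [coe_truncate]
  have hmm : (m : ℝ≥0∞) ≤ m' := by exact_mod_cast h
  refine (Set.indicator_le_indicator_of_subset
    (Metric.closedBall_subset_closedBall (Nat.cast_le.2 h)) (fun _ => zero_le) x).trans ?_
  exact Set.indicator_le_indicator (by gcongr)

theorem iSup_coe_truncate (g : Plane → ℝ≥0∞) (x : Plane) :
    ⨆ m, (truncate g m x : ℝ≥0∞) = g x := by
  refine le_antisymm (iSup_le fun m => ?_) (le_of_forall_lt fun c hc => ?_)
  · rw [coe_truncate]
    exact (Set.indicator_le_self' (fun _ _ => zero_le) x).trans (min_le_left _ _)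
  · obtain ⟨m, hm⟩ := exists_nat_gt ‖x‖
    obtain ⟨m', hm'⟩ := ENNReal.exists_nat_gt (ne_top_of_lt hc)
    refine lt_of_lt_of_le ?_ (le_iSup _ (max m m'))
    rw [coe_truncate, Set.indicator_of_mem, lt_min_iff]
    · refine ⟨hc, hm'.trans_le ?_⟩
      exact_mod_cast le_max_right _ _
    · rw [mem_closedBall_zero_iff]
      refine hm.le.trans ?_
      exact_mod_cast le_max_left _ _

theorem integrable_truncate {g : Plane → ℝ≥0∞} (hg : Measurable g) (m : ℕ) :
    Integrable fun x => ((truncate g m x : ℝ) : ℂ) := by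
  have hmeas : Measurable fun x => ((truncate g m x : ℝ) : ℂ) := by
    have := measurable_truncate hg m
    fun_prop
  refine ⟨hmeas.aestronglyMeasurable, ?_⟩
  rw [hasFiniteIntegral_iff_enorm]
  have e : ∀ x, ‖((truncate g m x : ℝ) : ℂ)‖ₑ ≤
      (Metric.closedBall (0 : Plane) m).indicator (fun _ => (m : ℝ≥0∞)) x := fun x => by
    rw [← ofReal_norm, Complex.norm_real, NNReal.norm_eq, ENNReal.ofReal_coe_nnreal, coe_truncate]
    exact Set.indicator_le_indicator (min_le_right _ _)
  refine (lintegral_mono e).trans_lt ?_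
  rw [lintegral_indicator_const measurableSet_closedBall]
  exact ENNReal.mul_lt_top (ENNReal.natCast_lt_top m) measure_closedBall_lt_top

/-- The `L²` bound for the dyadic maximal functions is linear in the logarithm of the
eccentricity. -/
theorem exists_lintegral_dyadicMax_sq_le : ∃ C : ℝ≥0∞, C ≠ ∞ ∧
    ∀ (n : ℕ) (g : Plane → ℝ≥0∞), Measurable g →
      ∫⁻ x, dyadicMax n g x ^ 2 ≤ C * (n + 1) ^ 2 * ∫⁻ x, g x ^ 2 := by
  obtain ⟨C, hC, h⟩ := exists_lintegral_dyadicMax_sq_le_of_bounded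
  refine ⟨C, hC, fun n g hg => ?_⟩
  have hmono : Monotone fun m x => dyadicMax n (fun y => (truncate g m y : ℝ≥0∞)) x := by
    intro m m' hm x
    exact iSup_mono fun k => iSup₂_mono fun j _ => lintegral_mono fun w =>
      monotone_coe_truncate g hm _
  have hsup : ∀ x, dyadicMax n g x ≤ ⨆ m, dyadicMax n (fun y => (truncate g m y : ℝ≥0∞)) x := by
    intro x
    refine iSup_le fun k => iSup₂_le fun j hj => ?_
    rw [gaussAvg]
    simp_rw [← iSup_coe_truncate g]
    rw [lintegral_iSup (f := fun m w => (truncate g m (x - dyadicShear n j k w) : ℝ≥0∞))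
      (fun m => by
        have := measurable_truncate hg m
        have := measurable_dyadicShear n j k
        fun_prop) (fun m m' hm w => monotone_coe_truncate g hm _)]
    exact iSup_mono fun m => le_iSup_of_le k (le_iSup₂_of_le j hj le_rfl)
  calc ∫⁻ x, dyadicMax n g x ^ 2
      ≤ ∫⁻ x, ⨆ m, dyadicMax n (fun y => (truncate g m y : ℝ≥0∞)) x ^ 2 := by
        refine lintegral_mono fun x => ?_
        refine (pow_le_pow_left₀ (zero_le) (hsup x) 2).trans_eq ?_
        exact Monotone.map_iSup_of_continuousAt (f := fun t : ℝ≥0∞ => t ^ 2)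
          (ENNReal.continuous_pow 2).continuousAt (fun a b hab => pow_le_pow_left₀ (zero_le) hab 2)
          (by simp)
    _ = ⨆ m, ∫⁻ x, dyadicMax n (fun y => (truncate g m y : ℝ≥0∞)) x ^ 2 :=
        lintegral_iSup (fun m => (measurable_dyadicMax n
          (measurable_truncate hg m).coe_nnreal_ennreal).pow_const 2)
          (fun m m' hm x => pow_le_pow_left₀ (zero_le) (hmono hm x) 2)
    _ ≤ _ := iSup_le fun m => by
        refine (h n (truncate g m) m (measurable_truncate hg m) (truncate_le g m)
          (integrable_truncate hg m)).trans ?_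
        gcongr with x
        rw [← iSup_coe_truncate g x]
        exact le_iSup (fun m => (truncate g m x : ℝ≥0∞)) m

end Telescoping

/-! ### From rectangles to dyadic parallelograms; the `L²` bound -/

section Rectangles

/-- The Kakeya maximal function of a function with values in `[0, ∞]`. -/
def kakeyaMax (N : ℝ) (g : Plane → ℝ≥0∞) (x : Plane) : ℝ≥0∞ :=
  ⨆ (R : Set Plane) (_ : R ∈ rectangles N) (_ : x ∈ R), ⨍⁻ y in R, g y ∂volume

theorem isClosed_rectangle (e : OrthonormalBasis (Fin 2) ℝ Plane) (c : Plane) (a b : ℝ) :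
    IsClosed (rectangle e c a b) := by
  have h : ∀ i, Continuous fun y => |inner ℝ (e i) (y - c)| := fun i => by fun_prop
  exact (isClosed_le (h 0) continuous_const).inter (isClosed_le (h 1) continuous_const)

theorem measurableSet_rectangle (e : OrthonormalBasis (Fin 2) ℝ Plane) (c : Plane) (a b : ℝ) :
    MeasurableSet (rectangle e c a b) :=
  (isClosed_rectangle e c a b).measurableSet

theorem add_sq_le_two_mul (a b : ℝ≥0∞) : (a + b) ^ 2 ≤ 2 * (a ^ 2 + b ^ 2) := by
  have := ENNReal.rpow_add_le_mul_rpow_add_rpow a b (p := 2) (by norm_num)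
  norm_num at this
  exact this

theorem volume_rectangle (e : OrthonormalBasis (Fin 2) ℝ Plane) (c : Plane) {a b : ℝ}
    (ha : 0 ≤ a) : volume (rectangle e c a b) = ENNReal.ofReal (a * b) := by
  set Q : Set (Fin 2 → ℝ) := Set.univ.pi fun i => Set.Icc (-(![a, b] i) / 2) (![a, b] i / 2)
  have hQ : MeasurableSet Q := MeasurableSet.univ_pi fun i => measurableSet_Icc
  have h1 : rectangle e c a b = (fun y => y - c) ⁻¹' (e.repr ⁻¹' (WithLp.ofLp ⁻¹' Q)) := by
    ext y
    simp only [rectangle, Q, abs_le, OrthonormalBasis.repr_apply_apply, Set.mem_univ_pi,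
      Fin.forall_fin_two, neg_div, Set.mem_preimage, Set.mem_Icc, Set.mem_ofPred_eq]
    rfl
  have hQ' := (PiLp.volume_preserving_ofLp (Fin 2)).measurable hQ
  rw [h1, (measurePreserving_sub_right volume c).measure_preimage
    (e.measurePreserving_repr.measurable hQ').nullMeasurableSet, e.measurePreserving_repr.measure_preimage
    hQ'.nullMeasurableSet,
    (PiLp.volume_preserving_ofLp (Fin 2)).measure_preimage hQ.nullMeasurableSet]
  simp only [Q, volume_pi_pi, Real.volume_Icc, Fin.prod_univ_two]
  simp only [Matrix.cons_val_zero, Matrix.cons_val_one]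
  rw [ENNReal.ofReal_mul ha]
  congr 2 <;> ring

theorem norm_sq_sub_le_of_mem_rectangle {e : OrthonormalBasis (Fin 2) ℝ Plane} {c : Plane}
    {a b : ℝ} {x y : Plane} (hx : x ∈ rectangle e c a b) (hy : y ∈ rectangle e c a b) :
    |inner ℝ (e 0) (x - y)| ≤ a ∧ |inner ℝ (e 1) (x - y)| ≤ b ∧
      ‖x - y‖ ^ 2 = inner ℝ (e 0) (x - y) ^ 2 + inner ℝ (e 1) (x - y) ^ 2 := by
  have h : ∀ i, inner ℝ (e i) (x - y) = inner ℝ (e i) (x - c) - inner ℝ (e i) (y - c) :=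
    fun i => by rw [← inner_sub_right]; congr 1; abel
  refine ⟨?_, ?_, ?_⟩
  · rw [h]
    refine (abs_sub _ _).trans ?_
    linarith [hx.1, hy.1]
  · rw [h]
    refine (abs_sub _ _).trans ?_
    linarith [hx.2, hy.2]
  · have := e.sum_sq_norm_inner_right (x - y)
    rw [Fin.sum_univ_two] at this
    simpa using this.symm

/-- Gaussian averages dominate averages over sets contained in a fixed dilate. -/
theorem setLIntegral_le_gaussAvg {a b s : ℝ} (ha : 0 < a) (hb : 0 < b) {g : Plane → ℝ≥0∞}
    (hg : Measurable g) {R : Set Plane} (hR : MeasurableSet R) {x : Plane} {ρ : ℝ}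
    (h : ∀ w, x - shearMap a b s w ∈ R → ‖w‖ ^ 2 ≤ ρ) :
    ∫⁻ y in R, g y ≤ ENNReal.ofReal (Real.exp (Real.pi * ρ) * (a * b)) *
      gaussAvg (shearMap a b s) g x := by
  have hB := measurable_shearMap a b s
  have hG : Measurable fun z => R.indicator g (x - z) := (hg.indicator hR).comp (by fun_prop)
  have h1 := lintegral_shearMap ha hb s hG
  rw [lintegral_sub_left_eq_self (fun z => R.indicator g z) x, lintegral_indicator hR] at h1
  have h0 : ENNReal.ofReal (a * b) ≠ 0 := (ENNReal.ofReal_pos.2 (by positivity)).ne'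
  have h2 : ∫⁻ y in R, g y =
      ENNReal.ofReal (a * b) * ∫⁻ w, R.indicator g (x - shearMap a b s w) := by
    rw [h1, ← mul_assoc, ENNReal.mul_inv_cancel h0 ENNReal.ofReal_ne_top, one_mul]
  have h3 : ENNReal.ofReal (Real.exp (Real.pi * ρ) * (a * b)) =
      ENNReal.ofReal (a * b) * ENNReal.ofReal (Real.exp (Real.pi * ρ)) := by
    rw [mul_comm, ENNReal.ofReal_mul (by positivity)]
  rw [h2, h3, mul_assoc, gaussAvg,
    gaussMeasure, lintegral_withDensity_eq_lintegral_mul _ (by fun_prop) (by fun_prop)]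
  gcongr ENNReal.ofReal (a * b) * ?_
  rw [← lintegral_const_mul' _ _ ENNReal.ofReal_ne_top]
  refine lintegral_mono fun w => ?_
  by_cases hw : x - shearMap a b s w ∈ R
  · rw [Set.indicator_of_mem hw, Pi.mul_apply, ← mul_assoc, ← ENNReal.ofReal_mul (by positivity),
      ← Real.exp_add]
    refine le_mul_of_one_le_left zero_le ?_
    rw [ENNReal.one_le_ofReal]
    refine Real.one_le_exp ?_
    have := mul_le_mul_of_nonneg_left (h w hw) Real.pi_pos.le
    linarith
  · rw [Set.indicator_of_notMem hw]; exact zero_le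

theorem laverage_rectangle (e : OrthonormalBasis (Fin 2) ℝ Plane) (c : Plane) {a b : ℝ}
    (ha : 0 ≤ a) (g : Plane → ℝ≥0∞) :
    ⨍⁻ y in rectangle e c a b, g y ∂volume =
      (ENNReal.ofReal (a * b))⁻¹ * ∫⁻ y in rectangle e c a b, g y := by
  rw [setLAverage_eq, volume_rectangle e c ha, div_eq_mul_inv, mul_comm]

/-- Here `(p, q)` is the long direction, `z` a difference of two points of the rectangle, `w` its
preimage under the dyadic shear, `T` the dyadic length and `S` the dyadic eccentricity. The diameter
gives `w0 ^ 2 ≤ 8`. As the long direction has slope at most one, the vertical distance `z1 - q / p *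
z0` to it is at most `√2 * |a|`. Rounding the slope to `j / S` moves this by at most `|w0| * T / S`,
so `w1 ^ 2 ≤ 32`. -/
theorem sq_add_sq_le_of_aligned {p q a T S j z0 z1 w0 w1 β : ℝ} (hT : 0 < T) (hS : 0 < S)
    (hunit : p ^ 2 + q ^ 2 = 1) (hp : 1 ≤ 2 * p ^ 2) (hβ : β ^ 2 ≤ a ^ 2)
    (hz : z0 ^ 2 + z1 ^ 2 = β ^ 2 + (p * z0 + q * z1) ^ 2) (hβT : β ^ 2 ≤ 4 * T ^ 2)
    (hα : (p * z0 + q * z1) ^ 2 ≤ 4 * T ^ 2) (ha : a ^ 2 ≤ 4 * (T / S) ^ 2)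
    (hz0 : z0 = T * w0) (hz1 : z1 = j / S * T * w0 + T / S * w1)
    (hj : (S * (q / p) - j) ^ 2 ≤ 1) : w0 ^ 2 + w1 ^ 2 ≤ 40 := by
  have hp0 : p ≠ 0 := fun h => by rw [h] at hp; norm_num at hp
  have hcross : (p * z1 - q * z0) ^ 2 ≤ a ^ 2 := by
    have : (p * z1 - q * z0) ^ 2 + (p * z0 + q * z1) ^ 2 = z0 ^ 2 + z1 ^ 2 := by
      linear_combination (z0 ^ 2 + z1 ^ 2) * hunit
    linarith
  have hz02 : w0 ^ 2 * T ^ 2 ≤ 8 * T ^ 2 := by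
    have : z0 ^ 2 = w0 ^ 2 * T ^ 2 := by rw [hz0]; ring
    linarith [sq_nonneg z1]
  have hw0 : w0 ^ 2 ≤ 8 := le_of_mul_le_mul_right hz02 (by positivity)
  have hv : (z1 - q / p * z0) ^ 2 ≤ 2 * a ^ 2 := by
    have e1 : (p * z1 - q * z0) ^ 2 = p ^ 2 * (z1 - q / p * z0) ^ 2 := by field_simp
    rw [e1] at hcross
    have := mul_le_mul_of_nonneg_right hp (sq_nonneg (z1 - q / p * z0))
    linarith
  have hb0 : 0 < T / S := by positivity
  set b : ℝ := T / S with hb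
  have e2 : b * w1 = (z1 - q / p * z0) + (S * (q / p) - j) * w0 * b := by
    rw [hz1, hz0, hb]; field_simp; ring
  have h4 : ((S * (q / p) - j) * w0 * b) ^ 2 ≤ 8 * b ^ 2 := by
    rw [mul_pow, mul_pow]
    gcongr
    calc (S * (q / p) - j) ^ 2 * w0 ^ 2 ≤ 1 * 8 := by gcongr
      _ = 8 := by norm_num
  have h3 : w1 ^ 2 * b ^ 2 ≤ 32 * b ^ 2 := by
    have e3 : w1 ^ 2 * b ^ 2 = (b * w1) ^ 2 := by ring
    rw [e3, e2]
    linarith [add_sq_le (a := z1 - q / p * z0) (b := (S * (q / p) - j) * w0 * b)]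
  have hw1 : w1 ^ 2 ≤ 32 := le_of_mul_le_mul_right h3 (by positivity)
  linarith

/-- Averages over rectangles of slope at most one are dominated by the dyadic maximal function. -/
theorem laverage_rectangle_le_dyadicMax {N : ℝ} {n : ℕ} (hn1 : (2 : ℝ) ^ n ≤ N)
    (hn2 : N < 2 ^ (n + 1)) {g : Plane → ℝ≥0∞} (hg : Measurable g)
    (e : OrthonormalBasis (Fin 2) ℝ Plane) (c : Plane) {a : ℝ} (ha : 0 < a)
    (he : |e 1 1| ≤ |e 1 0|) {x : Plane} (hx : x ∈ rectangle e c a (N * a)) :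
    ⨍⁻ y in rectangle e c a (N * a), g y ∂volume ≤
      ENNReal.ofReal (2 * Real.exp (Real.pi * 40)) * dyadicMax n g x := by
  have hN1 : 1 ≤ N := le_trans (one_le_pow₀ (by norm_num)) hn1
  have hN : 0 < N := by linarith
  have h2n : (0 : ℝ) < 2 ^ n := by positivity
  obtain ⟨k, hk1, hk2⟩ := exists_mem_Ico_zpow (mul_pos hN ha) (one_lt_two : (1 : ℝ) < 2)
  have h2k : (0 : ℝ) < 2 ^ k := by positivity
  rw [zpow_add_one₀ two_ne_zero] at hk2
  rw [pow_succ] at hn2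
  have hunit : (e 1 0) ^ 2 + (e 1 1) ^ 2 = 1 := by
    have := e.norm_eq_one 1
    rw [← sq_eq_sq₀ (norm_nonneg _) zero_le_one, EuclideanSpace.norm_sq_eq,
      Fin.sum_univ_two] at this
    simpa using this
  have hc2 : 1 ≤ 2 * (e 1 0) ^ 2 := by
    have := sq_le_sq.2 he
    linarith
  have hc0 : e 1 0 ≠ 0 := fun h => by rw [h] at hc2; norm_num at hc2
  set s := e 1 1 / e 1 0 with hs
  have hs1 : |s| ≤ 1 := by
    rw [hs, abs_div, div_le_one (abs_pos.2 hc0)]; exact he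
  -- Rounding the slope down errs by at most `2⁻ⁿ`, which over the length `2 ^ k` is no more than
  -- the width of the parallelogram.
  set j := ⌊2 ^ n * s⌋ with hj
  have hj1 : (j : ℝ) ≤ 2 ^ n * s := Int.floor_le _
  have hj2 : 2 ^ n * s < j + 1 := Int.lt_floor_add_one _
  have hjn : |j| ≤ 2 ^ n := by
    rw [abs_le] at hs1 ⊢
    constructor
    · rw [hj, Int.le_floor]; push_cast; nlinarith
    · have : (j : ℝ) ≤ 2 ^ n := by nlinarith
      exact_mod_cast this
  have hab : a < 2 * (2 ^ k / 2 ^ n) := by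
    rw [mul_div_assoc', lt_div_iff₀ h2n]; nlinarith
  have key : ∀ w, x - dyadicShear n j k w ∈ rectangle e c a (N * a) → ‖w‖ ^ 2 ≤ 40 := by
    intro w hw
    obtain ⟨hα, hβ, hz⟩ := norm_sq_sub_le_of_mem_rectangle hx hw
    rw [sub_sub_cancel] at hα hβ hz
    set z := dyadicShear n j k w with hzdef
    have hz0 : z 0 = 2 ^ k * w 0 := by simp [hzdef, dyadicShear, shearMap]
    have hz1 : z 1 = j / 2 ^ n * 2 ^ k * w 0 + 2 ^ k / 2 ^ n * w 1 := by
      simp [hzdef, dyadicShear, shearMap]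
    have hα2 := sq_le_sq.2 (hα.trans (le_abs_self a))
    have hβ2 := sq_le_sq.2 (hβ.trans (le_abs_self (N * a)))
    have hin : inner ℝ (e 1) z = e 1 0 * z 0 + e 1 1 * z 1 := by
      simp [PiLp.inner_apply, Fin.sum_univ_two, mul_comm]
    rw [EuclideanSpace.norm_sq_eq, Fin.sum_univ_two] at hz ⊢
    simp only [Real.norm_eq_abs, sq_abs] at hz ⊢
    rw [hin] at hz hβ2
    have hNa : a ^ 2 ≤ (N * a) ^ 2 := by
      have : a ≤ N * a := le_mul_of_one_le_left ha.le hN1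
      gcongr
    have hNa2 : (N * a) ^ 2 ≤ 4 * (2 ^ k) ^ 2 := by
      have : N * a ≤ 2 ^ k * 2 := hk2.le
      calc (N * a) ^ 2 ≤ (2 ^ k * 2) ^ 2 := by gcongr
        _ = _ := by ring
    have ha2 : a ^ 2 ≤ 4 * (2 ^ k / 2 ^ n) ^ 2 := by
      calc a ^ 2 ≤ (2 * (2 ^ k / 2 ^ n)) ^ 2 := by gcongr
        _ = _ := by ring
    refine sq_add_sq_le_of_aligned h2k h2n hunit hc2 hα2 hz
      (hα2.trans (hNa.trans hNa2)) (hβ2.trans hNa2) ha2 hz0 hz1 ?_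
    have h0 : 0 ≤ 2 ^ n * s - j := by linarith
    have h1 : 2 ^ n * s - j ≤ 1 := by linarith
    exact pow_le_one₀ h0 h1
  have h1 := setLIntegral_le_gaussAvg (s := (j : ℝ) / 2 ^ n) h2k
    (by positivity : (0 : ℝ) < 2 ^ k / 2 ^ n) hg
    (measurableSet_rectangle e c a (N * a)) key
  rw [laverage_rectangle e c ha.le]
  calc _ ≤ (ENNReal.ofReal (a * (N * a)))⁻¹ * (ENNReal.ofReal (Real.exp (Real.pi * 40) *
        (2 ^ k * (2 ^ k / 2 ^ n))) * dyadicMax n g x) := by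
        gcongr
        refine h1.trans ?_
        gcongr
        exact le_iSup_of_le k (le_iSup₂_of_le j hjn le_rfl)
    _ ≤ _ := by
        rw [← mul_assoc, ← ENNReal.ofReal_inv_of_pos (by positivity),
          ← ENNReal.ofReal_mul (by positivity)]
        gcongr ENNReal.ofReal ?_ * _
        rw [inv_mul_le_iff₀ (by positivity)]
        -- The parallelogram has at most twice the area scale of the rectangle, because `2 ^ k ≤ N *
        -- a` and `N < 2 * 2 ^ n`.
        have : (2 : ℝ) ^ k * (2 ^ k / 2 ^ n) ≤ 2 * (a * (N * a)) := by
          rw [mul_div_assoc', div_le_iff₀ h2n]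
          calc (2 : ℝ) ^ k * 2 ^ k ≤ (N * a) * (N * a) := by gcongr
            _ = a * (N * a) * N := by ring
            _ ≤ a * (N * a) * (2 ^ n * 2) := by gcongr
            _ = _ := by ring
        calc _ ≤ Real.exp (Real.pi * 40) * (2 * (a * (N * a))) := by gcongr
          _ = _ := by ring

/-- The exchange of the two coordinates. -/
def coordSwap : Plane ≃ₗᵢ[ℝ] Plane :=
  LinearIsometryEquiv.piLpCongrLeft 2 ℝ ℝ (Equiv.swap 0 1)

theorem coordSwap_apply (x : Plane) (i : Fin 2) : coordSwap x i = x (Equiv.swap 0 1 i) := by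
  simp [coordSwap, LinearIsometryEquiv.piLpCongrLeft_apply]

/-- The dyadic family has slopes at most one; steeper rectangles are brought into this range by
exchanging the coordinates, which is a measure preserving isometry. -/
theorem kakeyaMax_le_dyadicMax {N : ℝ} {n : ℕ} (hn1 : (2 : ℝ) ^ n ≤ N)
    (hn2 : N < 2 ^ (n + 1)) {g : Plane → ℝ≥0∞} (hg : Measurable g) (x : Plane) :
    kakeyaMax N g x ≤ ENNReal.ofReal (2 * Real.exp (Real.pi * 40)) *
      (dyadicMax n g x + dyadicMax n (g ∘ coordSwap.symm) (coordSwap x)) := by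
  refine iSup_le fun R => iSup₂_le fun hR hxR => ?_
  obtain ⟨e, c, a, ha, rfl⟩ := hR
  rcases le_total |e 1 1| |e 1 0| with he | he
  · refine (laverage_rectangle_le_dyadicMax hn1 hn2 hg e c ha he hxR).trans ?_
    gcongr
    exact le_self_add
  · have hmem : ∀ y, y ∈ rectangle e c a (N * a) ↔
        coordSwap y ∈ rectangle (e.map coordSwap) (coordSwap c) a (N * a) := by
      intro y
      simp only [rectangle, Set.mem_ofPred_eq, OrthonormalBasis.map_apply, ← map_sub,
        LinearIsometryEquiv.inner_map_map]
    have hpre : rectangle e c a (N * a) =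
        coordSwap ⁻¹' rectangle (e.map coordSwap) (coordSwap c) a (N * a) := Set.ext hmem
    have h := laverage_rectangle_le_dyadicMax hn1 hn2
      (hg.comp coordSwap.symm.continuous.measurable) (e.map coordSwap) (coordSwap c) ha
      (x := coordSwap x) (by
        simp only [OrthonormalBasis.map_apply, coordSwap_apply]
        simpa using he) ((hmem x).1 hxR)
    have hint : ∫⁻ y in rectangle e c a (N * a), g y =
        ∫⁻ y in rectangle (e.map coordSwap) (coordSwap c) a (N * a), (g ∘ coordSwap.symm) y := by
      rw [hpre, ← coordSwap.measurePreserving.setLIntegral_comp_preimage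
        (measurableSet_rectangle _ _ _ _) (hg.comp coordSwap.symm.continuous.measurable)]
      simp
    rw [laverage_rectangle _ _ ha.le] at h ⊢
    rw [hint]
    refine h.trans ?_
    gcongr
    exact le_add_self

/-- The `L²` bound for the Kakeya maximal function. -/
theorem exists_lintegral_kakeyaMax_sq_le : ∃ C : ℝ, 0 < C ∧ ∀ N : ℝ, 2 ≤ N →
    ∀ g : Plane → ℝ≥0∞, Measurable g →
      ∫⁻ x, kakeyaMax N g x ^ 2 ≤ ENNReal.ofReal (C * Real.log N ^ 2) * ∫⁻ x, g x ^ 2 := by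
  obtain ⟨C, hC, h⟩ := exists_lintegral_dyadicMax_sq_le
  set K := 2 * Real.exp (Real.pi * 40)
  refine ⟨K ^ 2 * (4 * (C.toReal * 9)) + 1, by positivity, fun N hN g hg => ?_⟩
  have hN1 : 1 ≤ N := by linarith
  obtain ⟨n, hn1, hn2⟩ := exists_nat_pow_near hN1 (one_lt_two : (1 : ℝ) < 2)
  have hlog2 := Real.log_two_gt_d9
  have hlogN : Real.log 2 ≤ Real.log N := Real.log_le_log (by norm_num) hN
  -- Both `n * log 2` and `log 2` are at most `log N`, and `2 / log 2 < 3`.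
  have hn : (n : ℝ) + 1 ≤ 3 * Real.log N := by
    have h1 : n * Real.log 2 ≤ Real.log N := by
      rw [← Real.log_pow]
      exact Real.log_le_log (by positivity) hn1
    nlinarith [Nat.cast_nonneg (α := ℝ) n]
  have hswap : ∫⁻ x, dyadicMax n (g ∘ coordSwap.symm) (coordSwap x) ^ 2 ≤
      C * (n + 1) ^ 2 * ∫⁻ x, g x ^ 2 := by
    have hg' := hg.comp coordSwap.symm.continuous.measurable
    rw [coordSwap.measurePreserving.lintegral_comp ((measurable_dyadicMax n hg').pow_const 2)]
    refine (h n _ hg').trans_eq ?_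
    congr 1
    exact coordSwap.symm.measurePreserving.lintegral_comp (hg.pow_const 2)
  calc ∫⁻ x, kakeyaMax N g x ^ 2
      ≤ ∫⁻ x, ENNReal.ofReal (K ^ 2) * (2 * (dyadicMax n g x ^ 2 +
          dyadicMax n (g ∘ coordSwap.symm) (coordSwap x) ^ 2)) := by
        refine lintegral_mono fun x => ?_
        refine (pow_le_pow_left₀ zero_le (kakeyaMax_le_dyadicMax hn1 hn2 hg x) 2).trans ?_
        rw [mul_pow, ENNReal.ofReal_pow (by positivity)]
        gcongr
        exact add_sq_le_two_mul _ _
    _ = ENNReal.ofReal (K ^ 2) * (2 * ((∫⁻ x, dyadicMax n g x ^ 2) +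
          ∫⁻ x, dyadicMax n (g ∘ coordSwap.symm) (coordSwap x) ^ 2)) := by
        rw [lintegral_const_mul' _ _ ENNReal.ofReal_ne_top, lintegral_const_mul' _ _ (by norm_num),
          lintegral_add_left ((measurable_dyadicMax n hg).pow_const 2)]
    _ ≤ ENNReal.ofReal (K ^ 2) * (2 * ((C * (n + 1) ^ 2 * ∫⁻ x, g x ^ 2) +
          C * (n + 1) ^ 2 * ∫⁻ x, g x ^ 2)) := by
        gcongr
        exact h n g hg
    _ = (ENNReal.ofReal (K ^ 2) * (4 * (C * (n + 1) ^ 2))) * ∫⁻ x, g x ^ 2 := by ring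
    _ ≤ _ := by
        gcongr
        have e : ENNReal.ofReal (K ^ 2) * (4 * (C * (n + 1) ^ 2)) =
            ENNReal.ofReal (K ^ 2 * (4 * (C.toReal * (n + 1) ^ 2))) := by
          rw [ENNReal.ofReal_mul (by positivity), ENNReal.ofReal_mul (by norm_num),
            ENNReal.ofReal_mul (by positivity), ENNReal.ofReal_toReal hC,
            ENNReal.ofReal_pow (by positivity) 2, ENNReal.ofReal_pow (by positivity) 2,
            ENNReal.ofReal_add (by positivity) (by norm_num)]
          simp
        rw [e]
        refine ENNReal.ofReal_le_ofReal ?_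
        have h9 : ((n : ℝ) + 1) ^ 2 ≤ 9 * Real.log N ^ 2 := by
          calc ((n : ℝ) + 1) ^ 2 ≤ (3 * Real.log N) ^ 2 := by gcongr
            _ = _ := by ring
        calc _ ≤ K ^ 2 * (4 * (C.toReal * (9 * Real.log N ^ 2))) := by gcongr
          _ ≤ _ := by nlinarith [sq_nonneg (Real.log N)]

end Rectangles

/-! ### Measurability and sublinearity of the Kakeya maximal function -/

section Measurability

theorem rectangle_subset_rectangle (e : OrthonormalBasis (Fin 2) ℝ Plane) (c : Plane)
    {a b a' b' : ℝ} (ha : a ≤ a') (hb : b ≤ b') : rectangle e c a b ⊆ rectangle e c a' b' :=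
  fun _ hy => ⟨hy.1.trans (by linarith), hy.2.trans (by linarith)⟩

/-- A slightly larger concentric rectangle contains a neighbourhood of `x`, and its average is still
above `t` because the area varies continuously. This gives measurability despite the uncountable
supremum. -/
theorem lowerSemicontinuous_kakeyaMax {N : ℝ} (hN : 0 < N) (g : Plane → ℝ≥0∞) :
    LowerSemicontinuous (kakeyaMax N g) := by
  intro x t ht
  simp only [kakeyaMax, lt_iSup_iff] at ht
  obtain ⟨R, ⟨e, c, a, ha, rfl⟩, hx, ht⟩ := ht
  rw [laverage_rectangle e c ha.le] at ht
  set I := ∫⁻ y in rectangle e c a (N * a), g y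
  have hpos : ∀ᶠ a' in nhdsWithin a (Set.Ioi a), t < (ENNReal.ofReal (a' * (N * a')))⁻¹ * I := by
    rcases eq_or_ne I ∞ with hI | hI
    · filter_upwards [self_mem_nhdsWithin] with a' ha'
      rw [hI, ENNReal.mul_top (by simp)]
      exact lt_of_lt_of_le ht le_top
    · have hc : ContinuousAt (fun a' : ℝ => (ENNReal.ofReal (a' * (N * a')))⁻¹ * I) a := by
        refine ENNReal.Tendsto.mul_const ?_ (Or.inr hI)
        have : Continuous fun a' : ℝ => (ENNReal.ofReal (a' * (N * a')))⁻¹ :=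
          continuous_inv.comp (ENNReal.continuous_ofReal.comp (by fun_prop))
        exact this.continuousAt
      exact (hc.eventually (lt_mem_nhds ht)).filter_mono nhdsWithin_le_nhds
  obtain ⟨a', h1, h2⟩ := (hpos.and self_mem_nhdsWithin).exists
  have haa' : a < a' := h2
  have hopen : IsOpen {y | |inner ℝ (e 0) (y - c)| < a' / 2 ∧ |inner ℝ (e 1) (y - c)| < N * a' / 2} := by
    have h : ∀ i, Continuous fun y => |inner ℝ (e i) (y - c)| := fun i => by fun_prop
    exact (isOpen_lt (h 0) continuous_const).inter (isOpen_lt (h 1) continuous_const)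
  have hNa : N * a < N * a' := by gcongr
  filter_upwards [hopen.mem_nhds ⟨hx.1.trans_lt (by linarith), hx.2.trans_lt (by linarith)⟩]
    with y hy
  refine h1.trans_le ?_
  refine le_trans ?_ (le_iSup₂_of_le (rectangle e c a' (N * a')) ⟨e, c, a', ha.trans haa', rfl⟩
    (le_iSup_of_le ⟨hy.1.le, hy.2.le⟩ le_rfl))
  rw [laverage_rectangle e c (ha.trans haa').le]
  gcongr
  exact lintegral_mono_set (rectangle_subset_rectangle e c haa'.le hNa.le)

theorem measurable_kakeyaMax {N : ℝ} (hN : 0 < N) (g : Plane → ℝ≥0∞) :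
    Measurable (kakeyaMax N g) :=
  (lowerSemicontinuous_kakeyaMax hN g).measurable

theorem kakeyaMax_congr_ae {N : ℝ} {g g' : Plane → ℝ≥0∞} (h : g =ᵐ[volume] g') (x : Plane) :
    kakeyaMax N g x = kakeyaMax N g' x := by
  exact iSup_congr fun R => iSup_congr fun _ => iSup_congr fun _ =>
    laverage_congr (ae_restrict_of_ae h)

theorem laverage_le_kakeyaMax {N : ℝ} {R : Set Plane} (hR : R ∈ rectangles N) {x : Plane}
    (hx : x ∈ R) (g : Plane → ℝ≥0∞) : ⨍⁻ y in R, g y ∂volume ≤ kakeyaMax N g x :=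
  le_iSup₂_of_le R hR (le_iSup_of_le hx le_rfl)

theorem kakeyaMax_mul_const {N : ℝ} (g : Plane → ℝ≥0∞) {c : ℝ≥0∞} (hc : c ≠ ∞) (x : Plane) :
    kakeyaMax N (fun y => g y * c) x = kakeyaMax N g x * c := by
  simp only [kakeyaMax, ENNReal.iSup_mul]
  congr! 6 with R hR hx
  rw [setLAverage_eq, setLAverage_eq, lintegral_mul_const' _ _ hc, ENNReal.mul_div_right_comm]

theorem kakeyaMax_add_le {N : ℝ} {g g' : Plane → ℝ≥0∞} (hg : Measurable g) (x : Plane) :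
    kakeyaMax N (fun y => g y + g' y) x ≤ kakeyaMax N g x + kakeyaMax N g' x := by
  refine iSup_le fun R => iSup₂_le fun hR hx => ?_
  refine le_trans (le_of_eq ?_) (add_le_add (laverage_le_kakeyaMax hR hx g)
    (laverage_le_kakeyaMax hR hx g'))
  rw [setLAverage_eq, setLAverage_eq, setLAverage_eq, lintegral_add_left hg, ENNReal.add_div]

end Measurability

/-! ### Consequences of log-Hölder continuity of the exponent -/

section Exponent

variable {p : Plane → ℝ}

theorem LocallyLogHolder.continuous (h : LocallyLogHolder p) : Continuous p := by
  obtain ⟨c, hc, h⟩ := h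
  rw [Metric.continuous_iff]
  intro x ε hε
  refine ⟨Real.exp (-(c / ε)), Real.exp_pos _, fun y hy => ?_⟩
  rw [dist_eq_norm] at hy
  rcases eq_or_ne y x with rfl | hne
  · simpa
  have hpos : 0 < ‖y - x‖ := norm_pos_iff.2 (sub_ne_zero.2 hne)
  have h1 : ‖y - x‖ < 1 := hy.trans_le (Real.exp_le_one_iff.2 (by
    have := div_pos hc hε; linarith))
  have h2 := h y x h1
  have h3 : c / ε < Real.log (1 / ‖y - x‖) := by
    rw [one_div, Real.log_inv]
    have := Real.log_lt_log hpos hy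
    rw [Real.log_exp] at this
    linarith
  rw [Real.dist_eq]
  by_contra hcon
  push Not at hcon
  have h4 : c / ε * ε = c := div_mul_cancel₀ _ hε.ne'
  have h5 : 0 < c / ε := div_pos hc hε
  nlinarith

/-- The set where `p` falls below `q` is open and null, hence empty. So the essential lower bound
may be used at every point. -/
theorem le_of_le_pMinus (hp : Continuous p) {q : ℝ} (h : (q : EReal) ≤ pMinus p) (x : Plane) :
    q ≤ p x := by
  have hae : ∀ᵐ y, q ≤ p y := by
    filter_upwards [ae_essInf_le (f := fun x => (p x : EReal)) (μ := (volume : Measure Plane))]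
      with y hy
    exact EReal.coe_le_coe_iff.1 (h.trans hy)
  by_contra hx
  have hopen : IsOpen {y | p y < q} := isOpen_lt hp continuous_const
  refine (hopen.measure_pos volume ⟨x, not_le.1 hx⟩).ne' ?_
  have h0 : volume {y | ¬ q ≤ p y} = 0 := hae
  simpa only [not_le] using h0

theorem le_oscConst (hp1 : ∀ x, 1 ≤ p x) {N : ℝ} {x y : Plane} (h : ‖x - y‖ < Real.sqrt N) :
    |1 / p x - 1 / p y| ≤ oscConst p N := by
  refine le_csSup ⟨1, ?_⟩ ⟨x, y, h, rfl⟩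
  rintro t ⟨x, y, -, rfl⟩
  have h1 : ∀ z, 0 ≤ 1 / p z ∧ 1 / p z ≤ 1 := fun z =>
    ⟨by have := hp1 z; positivity, by rw [div_le_one (by linarith [hp1 z])]; exact hp1 z⟩
  rw [abs_le]
  constructor <;> linarith [(h1 x).1, (h1 x).2, (h1 y).1, (h1 y).2]

theorem oscConst_nonneg (hp1 : ∀ x, 1 ≤ p x) {N : ℝ} (hN : 0 < N) : 0 ≤ oscConst p N :=
  (abs_nonneg _).trans (le_oscConst hp1 (x := 0) (y := 0) (by simpa using hN))

/-- On rectangles of length at most `√N / 2` the measure may be raised to the oscillation of `1 / p`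
at the cost of a power of the eccentricity. -/
theorem exists_inv_rpow_le (hp2 : ∀ x, 2 ≤ p x) (hloc : LocallyLogHolder p) :
    ∃ C : ℝ, 1 ≤ C ∧ ∀ (N : ℝ) (e : OrthonormalBasis (Fin 2) ℝ Plane) (c : Plane) (a : ℝ)
      (x y : Plane), 2 ≤ N → 0 < a → N * a ≤ Real.sqrt N / 2 → x ∈ rectangle e c a (N * a) →
      y ∈ rectangle e c a (N * a) → p y ≤ p x →
      (a * (N * a))⁻¹ ^ (1 / p y - 1 / p x) ≤ C * N ^ oscConst p N := by
  obtain ⟨c₀, hc₀, h⟩ := hloc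
  refine ⟨Real.exp (c₀ / 2 + 1), Real.one_le_exp (by positivity), ?_⟩
  intro N e c a x y hN ha hL hx hy hxy
  have hN0 : 0 < N := by linarith
  have hpx := hp2 x
  have hpy := hp2 y
  set L := N * a with hLdef
  have hL0 : 0 < L := by positivity
  have haL : a ≤ L / 2 := by rw [hLdef]; nlinarith
  set θ := 1 / p y - 1 / p x with hθ
  have hθ0 : 0 ≤ θ := sub_nonneg.2 (one_div_le_one_div_of_le (by linarith) hxy)
  have hθ2 : θ ≤ 1 / 2 := by
    have h1 : 1 / p y ≤ 1 / 2 := one_div_le_one_div_of_le (by norm_num) hpy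
    have h2 : 0 ≤ 1 / p x := by positivity
    linarith
  -- The difference `p x - p y` is divided by `p x * p y ≥ 4`.
  have hθp : θ ≤ |p x - p y| / 4 := by
    have : θ = (p x - p y) / (p x * p y) := by rw [hθ]; field_simp
    rw [this, abs_of_nonneg (by linarith)]
    have : 4 ≤ p x * p y := by nlinarith
    have : 0 ≤ p x - p y := by linarith
    gcongr
  obtain ⟨h1, h2, h3⟩ := norm_sq_sub_le_of_mem_rectangle hx hy
  have hdist : ‖x - y‖ ^ 2 ≤ 5 / 4 * L ^ 2 := by
    have := sq_le_sq.2 (h1.trans (le_abs_self a))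
    have := sq_le_sq.2 (h2.trans (le_abs_self L))
    nlinarith
  -- The squared diameter is at most `5 / 4 * L ^ 2 ≤ 5 / 16 * N`, so the two points compete in
  -- `oscConst`.
  have hosc : θ ≤ oscConst p N := by
    refine (le_abs_self θ).trans ?_
    rw [hθ]
    refine le_oscConst (fun z => by linarith [hp2 z]) ?_
    rw [norm_sub_rev]
    refine lt_of_pow_lt_pow_left₀ 2 (Real.sqrt_nonneg _) ?_
    have h4 : L ^ 2 ≤ (Real.sqrt N / 2) ^ 2 := by gcongr
    rw [div_pow, Real.sq_sqrt hN0.le] at h4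
    rw [Real.sq_sqrt hN0.le]
    linarith
  have hlog2 : Real.log 2 ≤ 1 := by linarith [Real.log_two_lt_d9]
  have hlogL : θ * (-Real.log L) ≤ c₀ / 4 + 1 / 2 := by
    have hle : -Real.log L ≤ Real.log 2 ∨ L < 1 / 2 := by
      rcases le_or_gt (1 / 2) L with h4 | h4
      · left
        have := Real.log_le_log (by norm_num) h4
        rw [one_div, Real.log_inv] at this
        linarith
      · exact Or.inr h4
    rcases hle with h4 | h4
    · nlinarith
    rcases eq_or_ne x y with rfl | hne
    · have : θ = 0 := by rw [hθ, sub_self]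
      rw [this, zero_mul]; positivity
    have hpos : 0 < ‖x - y‖ := norm_pos_iff.2 (sub_ne_zero.2 hne)
    have h5 : ‖x - y‖ ≤ 2 * L := by
      refine le_of_sq_le_sq ?_ (by positivity)
      nlinarith
    have h6 := h x y (by linarith)
    have h7 : Real.log (1 / ‖x - y‖) ≥ -Real.log L - Real.log 2 := by
      rw [one_div, Real.log_inv]
      have := Real.log_le_log hpos h5
      rw [Real.log_mul (by norm_num) hL0.ne'] at this
      linarith
    have h8 : 0 ≤ -Real.log L - Real.log 2 := by
      have := Real.log_le_log hL0 h4.le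
      rw [one_div, Real.log_inv] at this
      linarith
    have h9 : |p x - p y| * (-Real.log L - Real.log 2) ≤ c₀ :=
      le_trans (by gcongr) h6
    nlinarith [mul_le_mul_of_nonneg_right hθp h8]
  -- The inverse area is `N / L ^ 2`: the factor `N` produces `N ^ oscConst`, and the power of `L`
  -- is bounded by `hlogL`.
  have e1 : (a * L)⁻¹ = N * Real.exp (2 * -Real.log L) := by
    have : Real.exp (2 * -Real.log L) = (L ^ 2)⁻¹ := by
      rw [mul_neg, Real.exp_neg, two_mul, Real.exp_add, Real.exp_log hL0, sq]
    rw [this, hLdef]; field_simp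
  rw [e1, Real.mul_rpow hN0.le (Real.exp_pos _).le, ← Real.exp_mul, mul_comm]
  gcongr
  · linarith
  · linarith

/-- Comparison of two powers of a number in `[0, 1]` with log-Hölder close exponents. -/
theorem rpow_le_exp_mul_rpow_add {u : ℝ≥0∞} (hu : u ≤ 1) {α β c s : ℝ} (hα : 1 ≤ α) (hs : 1 ≤ s)
    (h : |α - β| * Real.log s ≤ c) :
    u ^ α ≤ ENNReal.ofReal (Real.exp (2 * c)) * u ^ β + ENNReal.ofReal (s ^ (-2 : ℝ)) := by
  have hs0 : 0 < s := by linarith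
  -- Below `s⁻²` the additive error absorbs everything; above it, changing the exponent costs at
  -- most `s ^ (2 * |α - β|)`, which is at most `exp (2 * c)`.
  rcases lt_or_ge u (ENNReal.ofReal (s ^ (-2 : ℝ))) with hlt | hge
  · calc u ^ α ≤ u ^ (1 : ℝ) := ENNReal.rpow_le_rpow_of_exponent_ge hu hα
      _ ≤ ENNReal.ofReal (s ^ (-2 : ℝ)) := by rw [ENNReal.rpow_one]; exact hlt.le
      _ ≤ _ := le_add_self
  · refine le_trans ?_ le_self_add
    have hut : u ≠ ∞ := ne_top_of_le_ne_top ENNReal.one_ne_top hu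
    have hur : s ^ (-2 : ℝ) ≤ u.toReal := (ENNReal.ofReal_le_iff_le_toReal hut).1 hge
    have hspos : 0 < s ^ (-2 : ℝ) := by positivity
    have hu0 : 0 < u.toReal := hspos.trans_le hur
    have hu1 : u.toReal ≤ 1 := ENNReal.toReal_le_of_le_ofReal zero_le_one (by simpa using hu)
    rw [← ENNReal.ofReal_toReal hut, ENNReal.ofReal_rpow_of_pos hu0,
      ENNReal.ofReal_rpow_of_pos hu0, ← ENNReal.ofReal_mul (Real.exp_pos _).le]
    refine ENNReal.ofReal_le_ofReal ?_
    set v := u.toReal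
    have e1 : v ^ α = v ^ (α - β) * v ^ β := by rw [← Real.rpow_add hu0]; congr 1; ring
    rw [e1]
    gcongr
    calc v ^ (α - β) ≤ v ^ (-|α - β|) :=
          Real.rpow_le_rpow_of_exponent_ge hu0 hu1 (neg_abs_le _)
      _ ≤ (s ^ (-2 : ℝ)) ^ (-|α - β|) :=
          Real.rpow_le_rpow_of_nonpos hspos hur (by simp)
      _ = Real.exp (2 * (|α - β| * Real.log s)) := by
          rw [← Real.rpow_mul hs0.le, Real.rpow_def_of_pos hs0]; congr 1; ring
      _ ≤ _ := by gcongr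

end Exponent

/-! ### Pointwise reduction to the exponent two -/

section Pointwise

variable {p : Plane → ℝ}

theorem isCompact_rectangle (e : OrthonormalBasis (Fin 2) ℝ Plane) (c : Plane) (a b : ℝ) :
    IsCompact (rectangle e c a b) := by
  refine Metric.isCompact_of_isClosed_isBounded (isClosed_rectangle e c a b) ?_
  refine Metric.isBounded_iff.2 ⟨Real.sqrt (a ^ 2 + b ^ 2), fun x hx y hy => ?_⟩
  obtain ⟨h1, h2, h3⟩ := norm_sq_sub_le_of_mem_rectangle hx hy
  rw [dist_eq_norm]
  refine Real.le_sqrt_of_sq_le ?_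
  have := sq_le_sq.2 (h1.trans (le_abs_self a))
  have := sq_le_sq.2 (h2.trans (le_abs_self b))
  linarith

theorem laverage_rpow_le {μ : Measure Plane} {R : Set Plane} (h0 : μ R ≠ 0) (ht : μ R ≠ ∞)
    {g : Plane → ℝ≥0∞} (hg : Measurable g) {r : ℝ} (hr : 1 ≤ r) :
    (⨍⁻ y in R, g y ∂μ) ^ r ≤ ⨍⁻ y in R, g y ^ r ∂μ := by
  have : IsFiniteMeasure (μ.restrict R) := ⟨by simpa using ht.lt_top⟩
  have : NeZero (μ.restrict R) := ⟨by simpa using h0⟩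
  exact lintegral_rpow_le_of_prob hg.aemeasurable hr

theorem laverage_mono {μ : Measure Plane} {f g : Plane → ℝ≥0∞} (h : ∀ y, f y ≤ g y) :
    ⨍⁻ y, f y ∂μ ≤ ⨍⁻ y, g y ∂μ :=
  lintegral_mono h

theorem volume_rectangle_ne_zero {N : ℝ} (hN : 0 < N) (e : OrthonormalBasis (Fin 2) ℝ Plane)
    (c : Plane) {a : ℝ} (ha : 0 < a) : volume (rectangle e c a (N * a)) ≠ 0 := by
  rw [volume_rectangle e c ha.le]
  exact (ENNReal.ofReal_pos.2 (by positivity)).ne'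

theorem volume_rectangle_ne_top (e : OrthonormalBasis (Fin 2) ℝ Plane)
    (c : Plane) {a b : ℝ} (ha : 0 < a) : volume (rectangle e c a b) ≠ ∞ := by
  rw [volume_rectangle e c ha.le]
  exact ENNReal.ofReal_ne_top

/-- Pointwise bound for functions whose nonzero values are at least one. -/
theorem exists_kakeyaMax_rpow_le_of_large (hp2 : ∀ x, 2 ≤ p x) (hloc : LocallyLogHolder p) :
    ∃ C : ℝ, 1 ≤ C ∧ ∀ (N : ℝ) (g : Plane → ℝ≥0∞), 2 ≤ N → Measurable g →
      (∀ y, g y = 0 ∨ 1 ≤ g y) → ∫⁻ y, g y ^ p y ≤ 1 → ∀ x,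
      (kakeyaMax N g x / ENNReal.ofReal (C * N ^ oscConst p N)) ^ p x ≤
        kakeyaMax N (fun y => g y ^ (p y / 2)) x ^ 2 := by
  obtain ⟨C, hC, h⟩ := exists_inv_rpow_le hp2 hloc
  have hpc := hloc.continuous
  refine ⟨4 * C, by linarith, fun N g hN hg hg1 hI x => ?_⟩
  have hN0 : 0 < N := by linarith
  have hpx := hp2 x
  set W := kakeyaMax N (fun y => g y ^ (p y / 2)) x
  set Λ := 4 * C * N ^ oscConst p N with hΛdef
  have hosc : 1 ≤ N ^ oscConst p N :=
    Real.one_le_rpow (by linarith) (oscConst_nonneg (fun z => by linarith [hp2 z]) hN0)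
  have hΛ : 4 ≤ Λ := by rw [hΛdef]; nlinarith
  have hΛ0 : ENNReal.ofReal Λ ≠ 0 := (ENNReal.ofReal_pos.2 (by linarith)).ne'
  have hmono : ∀ y, ∀ {s t : ℝ}, 0 < s → s ≤ t → g y ^ s ≤ g y ^ t := by
    intro y s t hs hst
    rcases hg1 y with h0 | h1
    · rw [h0, ENNReal.zero_rpow_of_pos hs]; exact zero_le
    · exact ENNReal.rpow_le_rpow_of_exponent_le h1 hst
  suffices hmain : kakeyaMax N g x ≤ (W ^ 2) ^ (p x)⁻¹ * ENNReal.ofReal Λ by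
    calc _ ≤ ((W ^ 2) ^ (p x)⁻¹) ^ p x := by
          gcongr
          exact (ENNReal.div_le_iff hΛ0 ENNReal.ofReal_ne_top).2 hmain
      _ = _ := ENNReal.rpow_inv_rpow (by linarith) _
  refine iSup_le fun R => iSup₂_le fun hR hx => ?_
  have hRW := laverage_le_kakeyaMax hR hx (fun y => g y ^ (p y / 2))
  obtain ⟨e, c, a, ha, rfl⟩ := hR
  set R := rectangle e c a (N * a)
  have hv0 := volume_rectangle_ne_zero hN0 e c ha
  have hvt := volume_rectangle_ne_top (b := N * a) e c ha
  have hv : 0 < a * (N * a) := by positivity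
  set U := ⨍⁻ y in R, g y ^ (p y / 2) ∂volume with hU
  have hpm : Measurable p := hpc.measurable
  have hIR : ⨍⁻ y in R, g y ^ p y ∂volume ≤ ENNReal.ofReal (a * (N * a))⁻¹ := by
    rw [laverage_rectangle e c ha.le, ENNReal.ofReal_inv_of_pos hv]
    exact mul_le_of_le_one_right zero_le ((setLIntegral_le_lintegral _ _).trans hI)
  rw [← ENNReal.div_le_iff hΛ0 ENNReal.ofReal_ne_top]
  suffices hmain : ((⨍⁻ y in R, g y ∂volume) / ENNReal.ofReal Λ) ^ p x ≤ U ^ 2 by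
    calc _ = (((⨍⁻ y in R, g y ∂volume) / ENNReal.ofReal Λ) ^ p x) ^ (p x)⁻¹ :=
          (ENNReal.rpow_rpow_inv (by linarith) _).symm
      _ ≤ _ := by gcongr; exact hmain.trans (by gcongr)
  rcases le_or_gt (N * a) (Real.sqrt N / 2) with hL | hL
  -- Short rectangles: Jensen with the minimal exponent `p y₀` gives `t ^ p x ≤ (U ^ 2) ^ (p x / p
  -- y₀)`. One factor `U ^ 2` is kept; the surplus power is estimated by `U ^ 2 ≤ |R|⁻¹`, a
  -- consequence of the modular bound, and absorbed in `Λ ^ p x`.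
  · obtain ⟨y₀, hy₀, hmin⟩ := (isCompact_rectangle e c a (N * a)).exists_isMinOn ⟨x, hx⟩
      hpc.continuousOn
    have hp0 := hp2 y₀
    have hpy₀ : p y₀ ≤ p x := hmin hx
    have h1 := h N e c a x y₀ hN ha hL hx hy₀ hpy₀
    set t := ⨍⁻ y in R, g y ∂volume
    have htU : t ^ (p y₀ / 2) ≤ U := by
      refine (laverage_rpow_le hv0 hvt hg (by linarith)).trans ?_
      refine lintegral_mono_ae ?_
      refine Measure.ae_smul_measure ?_ _
      refine (ae_restrict_iff' (measurableSet_rectangle e c a (N * a))).2 (ae_of_all _ fun y hy => ?_)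
      have : p y₀ ≤ p y := hmin hy
      exact hmono y (by linarith) (by linarith)
    have hU2 : U ^ 2 ≤ ENNReal.ofReal (a * (N * a))⁻¹ := by
      refine le_trans ?_ hIR
      have := laverage_rpow_le (g := fun y => g y ^ (p y / 2)) hv0 hvt (by fun_prop)
        (one_le_two : (1 : ℝ) ≤ 2)
      simp only [ENNReal.rpow_ofNat] at this
      refine this.trans_eq ?_
      congr 1; ext y
      rw [← ENNReal.rpow_natCast, ← ENNReal.rpow_mul]; congr 1; push_cast; ring
    have hpos : 0 ≤ p x / p y₀ - 1 := by
      rw [sub_nonneg, one_le_div (by linarith)]; exact hpy₀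
    have e1 : t ^ p x = ((t ^ (p y₀ / 2)) ^ 2) ^ (p x / p y₀) := by
      rw [← ENNReal.rpow_natCast, ← ENNReal.rpow_mul, ← ENNReal.rpow_mul]
      congr 1; push_cast; field_simp
    have e2 : (U ^ 2) ^ (p x / p y₀) = U ^ 2 * (U ^ 2) ^ (p x / p y₀ - 1) := by
      nth_rw 2 [← ENNReal.rpow_one (U ^ 2)]
      rw [← ENNReal.rpow_add_of_nonneg _ _ zero_le_one hpos]
      congr 1; ring
    have e3 : ENNReal.ofReal (a * (N * a))⁻¹ ^ (p x / p y₀ - 1) ≤ ENNReal.ofReal Λ ^ p x := by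
      have hexp : p x / p y₀ - 1 = (1 / p y₀ - 1 / p x) * p x := by field_simp
      rw [hexp, ENNReal.rpow_mul, ENNReal.ofReal_rpow_of_pos (by positivity)]
      gcongr
      refine h1.trans ?_
      rw [hΛdef, mul_assoc]
      have : 0 ≤ C * N ^ oscConst p N := by positivity
      linarith
    rw [ENNReal.div_rpow_of_nonneg _ _ (by linarith)]
    refine ENNReal.div_le_of_le_mul ?_
    calc t ^ p x ≤ (U ^ 2) ^ (p x / p y₀) := by rw [e1]; gcongr
      _ = U ^ 2 * (U ^ 2) ^ (p x / p y₀ - 1) := e2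
      _ ≤ U ^ 2 * ENNReal.ofReal Λ ^ p x := by
          gcongr
          exact le_trans (by gcongr) e3
  -- Long rectangles have area at least `1 / 4`, so `t ≤ 4 ≤ Λ`. The factor `4` in `Λ` serves to
  -- make `t / Λ ≤ 1`, after which the exponent may be lowered to `2`.
  · set t := ⨍⁻ y in R, g y ∂volume with htdef
    have hv4 : (a * (N * a))⁻¹ ≤ 4 := by
      rw [inv_le_comm₀ hv (by norm_num)]
      have h4 : (Real.sqrt N / 2) ^ 2 ≤ (N * a) ^ 2 := by gcongr
      rw [div_pow, Real.sq_sqrt hN0.le] at h4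
      have h5 : (N * a) ^ 2 = N * (a * (N * a)) := by ring
      rw [h5] at h4
      have h6 : N * (1 / 4) ≤ N * (a * (N * a)) := by linarith
      have := le_of_mul_le_mul_left h6 hN0
      linarith
    have ht4 : t ≤ 4 := by
      calc t ≤ ⨍⁻ y in R, g y ^ p y ∂volume := by
            refine laverage_mono fun y => ?_
            have := hmono y one_pos (by linarith [hp2 y] : 1 ≤ p y)
            rwa [ENNReal.rpow_one] at this
        _ ≤ ENNReal.ofReal (a * (N * a))⁻¹ := hIR
        _ ≤ ENNReal.ofReal 4 := ENNReal.ofReal_le_ofReal hv4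
        _ = 4 := by norm_num
    have h4Λ : 4 ≤ ENNReal.ofReal Λ := by
      rw [← ENNReal.ofReal_ofNat]; exact ENNReal.ofReal_le_ofReal hΛ
    have htU : t ≤ U := laverage_mono fun y => by
      have := hmono y one_pos (by linarith [hp2 y] : 1 ≤ p y / 2)
      rwa [ENNReal.rpow_one] at this
    calc (t / ENNReal.ofReal Λ) ^ p x ≤ (t / ENNReal.ofReal Λ) ^ (2 : ℝ) := by
          refine ENNReal.rpow_le_rpow_of_exponent_ge ?_ hpx
          exact ENNReal.div_le_of_le_mul (by rw [one_mul]; exact ht4.trans h4Λ)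
      _ = (t / ENNReal.ofReal Λ) ^ 2 := by simp
      _ ≤ t ^ 2 := by
          gcongr
          refine ENNReal.div_le_of_le_mul (le_mul_of_one_le_right zero_le ?_)
          exact le_trans (by norm_num) h4Λ
      _ ≤ U ^ 2 := by gcongr

/-- The decaying weight used to compare exponents at infinity. -/
def decay (y : Plane) : ℝ≥0∞ := ENNReal.ofReal ((Real.exp 1 + ‖y‖) ^ (-2 : ℝ))

theorem measurable_decay : Measurable decay := by
  unfold decay; fun_prop

/-- The squared weight decays with exponent `4`, above the dimension `2`. -/
theorem lintegral_decay_sq_lt_top : ∫⁻ y, decay y ^ 2 < ∞ := by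
  have h := finite_integral_one_add_norm (E := Plane) (μ := volume) (r := 4) (by simp; norm_num)
  refine lt_of_le_of_lt (lintegral_mono fun y => ?_) h
  have h1 : (1 : ℝ) ≤ Real.exp 1 := Real.one_le_exp zero_le_one
  have h2 : 0 ≤ ‖y‖ := norm_nonneg y
  have h3 : 0 < Real.exp 1 + ‖y‖ := by linarith
  rw [decay, ← ENNReal.ofReal_pow (by positivity), ← Real.rpow_natCast, ← Real.rpow_mul h3.le]
  refine ENNReal.ofReal_le_ofReal ?_
  rw [show (-2 : ℝ) * (2 : ℕ) = -4 by norm_num]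
  exact Real.rpow_le_rpow_of_nonpos (by linarith) (by linarith) (by norm_num)

/-- The limit exponent inherits the lower bound of `p` along points going to infinity; Jensen with
`q / 2 ≥ 1` relies on it. -/
theorem le_of_logHolder_limit (hp2 : ∀ x, 2 ≤ p x) {c q : ℝ}
    (h : ∀ x : Plane, |p x - q| * Real.log (Real.exp 1 + ‖x‖) ≤ c) : 2 ≤ q := by
  by_contra hq
  push Not at hq
  obtain ⟨M, hM⟩ := exists_gt (c / (2 - q))
  set x : Plane := EuclideanSpace.single 0 (Real.exp M)
  have hx : ‖x‖ = Real.exp M := by simp [x]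
  have h1 := h x
  have hpos : 0 < 2 - q := by linarith
  have h2 : 2 - q ≤ |p x - q| := le_trans (by linarith [hp2 x]) (le_abs_self _)
  have h3 : M ≤ Real.log (Real.exp 1 + ‖x‖) := by
    rw [hx, Real.le_log_iff_exp_le (by positivity)]
    linarith [Real.exp_pos 1]
  have h4 : 0 ≤ Real.log (Real.exp 1 + ‖x‖) :=
    Real.log_nonneg (by linarith [Real.one_le_exp (zero_le_one (α := ℝ)), norm_nonneg x])
  rw [div_lt_iff₀ hpos] at hM
  nlinarith [mul_le_mul_of_nonneg_right h2 h4]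

/-- Pointwise bound for functions with values in `[0, 1]`. -/
theorem exists_kakeyaMax_rpow_le_of_small (hp : Measurable p) (hp2 : ∀ x, 2 ≤ p x)
    (hinf : LogHolderAtInfinity p) :
    ∃ E : ℝ≥0∞, E ≠ ∞ ∧ ∀ (N : ℝ) (g : Plane → ℝ≥0∞), 2 ≤ N → Measurable g →
      (∀ y, g y ≤ 1) → ∀ x, kakeyaMax N g x ^ p x ≤
        (E * kakeyaMax N (fun y => g y ^ (p y / 2)) x + E * kakeyaMax N decay x + decay x) ^ 2 := by
  obtain ⟨c, q, h⟩ := hinf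
  have hq := le_of_logHolder_limit hp2 h
  have hlog : ∀ y : Plane, 1 ≤ Real.log (Real.exp 1 + ‖y‖) := fun y => by
    rw [Real.le_log_iff_exp_le (by positivity)]
    linarith [norm_nonneg y]
  have hs : ∀ y : Plane, 1 ≤ Real.exp 1 + ‖y‖ := fun y => by
    linarith [Real.one_le_exp (zero_le_one (α := ℝ)), norm_nonneg y]
  have hc : 0 ≤ c := le_trans (mul_nonneg (abs_nonneg _) (zero_le_one.trans (hlog 0))) (h 0)
  set E := ENNReal.ofReal (Real.exp (2 * (c / 2))) with hE
  have hE1 : 1 ≤ E := by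
    rw [hE, ENNReal.one_le_ofReal]; exact Real.one_le_exp (by positivity)
  have hhalf : ∀ y, |p y / 2 - q / 2| * Real.log (Real.exp 1 + ‖y‖) ≤ c / 2 := fun y => by
    have := h y
    rw [← sub_div, abs_div, abs_of_pos (by norm_num : (0 : ℝ) < 2)]
    linarith
  have hcmp1 : ∀ (u : ℝ≥0∞) y, u ≤ 1 → u ^ (q / 2) ≤ E * u ^ (p y / 2) + decay y :=
    fun u y hu => rpow_le_exp_mul_rpow_add hu (by linarith) (hs y)
      (by rw [abs_sub_comm]; exact hhalf y)
  have hcmp2 : ∀ (u : ℝ≥0∞) y, u ≤ 1 → u ^ (p y / 2) ≤ E * u ^ (q / 2) + decay y :=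
    fun u y hu => rpow_le_exp_mul_rpow_add hu (by linarith [hp2 y]) (hs y) (hhalf y)
  refine ⟨E * E, by simp [hE, ENNReal.mul_eq_top], fun N g hN hg hg1 x => ?_⟩
  have hN0 : 0 < N := by linarith
  have hpx := hp2 x
  set Z := E * E * kakeyaMax N (fun y => g y ^ (p y / 2)) x + E * E * kakeyaMax N decay x + decay x
  suffices hmain : kakeyaMax N g x ≤ Z ^ (p x / 2)⁻¹ by
    calc kakeyaMax N g x ^ p x ≤ (Z ^ (p x / 2)⁻¹) ^ p x := by gcongr
      _ = Z ^ 2 := by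
          rw [← ENNReal.rpow_mul, ← ENNReal.rpow_natCast]
          congr 1; push_cast; field_simp
  refine iSup_le fun R => iSup₂_le fun hR hx => ?_
  have hRW := laverage_le_kakeyaMax hR hx (fun y => g y ^ (p y / 2))
  have hRH := laverage_le_kakeyaMax hR hx decay
  obtain ⟨e, c', a, ha, rfl⟩ := hR
  set R := rectangle e c' a (N * a)
  have hv0 := volume_rectangle_ne_zero hN0 e c' ha
  have hvt := volume_rectangle_ne_top (b := N * a) e c' ha
  set t := ⨍⁻ y in R, g y ∂volume with ht
  have ht1 : t ≤ 1 := by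
    have : IsFiniteMeasure (volume.restrict R) := ⟨by simpa using hvt.lt_top⟩
    have : NeZero (volume.restrict R) := ⟨by simpa using hv0⟩
    exact (laverage_mono hg1).trans_eq (by simp)
  have hgp : Measurable fun y => g y ^ (p y / 2) := by fun_prop
  have h1 : t ^ (q / 2) ≤ E * (⨍⁻ y in R, g y ^ (p y / 2) ∂volume) + ⨍⁻ y in R, decay y ∂volume := by
    refine (laverage_rpow_le hv0 hvt hg (by linarith)).trans ?_
    refine (laverage_mono fun y => hcmp1 (g y) y (hg1 y)).trans_eq ?_
    simp only [laverage]
    rw [lintegral_add_right _ measurable_decay, lintegral_const_mul _ hgp]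
  rw [ENNReal.le_rpow_inv_iff (by linarith)]
  -- The exponent is replaced by `q` at `x`, Jensen is applied with the constant exponent `q / 2`,
  -- and `q` is changed back to `p y` inside the average.
  calc t ^ (p x / 2) ≤ E * t ^ (q / 2) + decay x := hcmp2 t x ht1
    _ ≤ E * (E * kakeyaMax N (fun y => g y ^ (p y / 2)) x + kakeyaMax N decay x) + decay x := by
        exact add_le_add (mul_le_mul' le_rfl
          (h1.trans (add_le_add (mul_le_mul' le_rfl hRW) hRH))) le_rfl
    _ ≤ _ := by
        rw [mul_add, ← mul_assoc]
        exact add_le_add (add_le_add le_rfl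
          (mul_le_mul' (le_mul_of_one_le_right zero_le hE1) le_rfl)) le_rfl

end Pointwise

/-! ### The modular inequality -/

section Modular

variable {p : Plane → ℝ}

/-- Modular inequality for normalized functions. -/
theorem exists_lintegral_kakeyaMax_rpow_le (hp2 : ∀ x, 2 ≤ p x) (hloc : LocallyLogHolder p)
    (hinf : LogHolderAtInfinity p) :
    ∃ C D : ℝ, 1 ≤ C ∧ 0 < D ∧ ∀ (N : ℝ) (g : Plane → ℝ≥0∞), 2 ≤ N → Measurable g →
      ∫⁻ y, g y ^ p y ≤ 1 →
      ∫⁻ x, (kakeyaMax N g x / ENNReal.ofReal (C * N ^ oscConst p N)) ^ p x ≤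
        ENNReal.ofReal (D * Real.log N ^ 2) := by
  have hp : Measurable p := hloc.continuous.measurable
  obtain ⟨C, hC, hlarge⟩ := exists_kakeyaMax_rpow_le_of_large hp2 hloc
  obtain ⟨E, hE, hsmall⟩ := exists_kakeyaMax_rpow_le_of_small hp hp2 hinf
  obtain ⟨K, hK, hL2⟩ := exists_lintegral_kakeyaMax_sq_le
  set H := ∫⁻ y, decay y ^ 2 with hH
  have hHt : H ≠ ∞ := lintegral_decay_sq_lt_top.ne
  set F := 1 + 4 * E ^ 2 + 4 * E ^ 2 * H with hF
  have hFt : F ≠ ∞ := by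
    rw [hF]; finiteness
  refine ⟨2 * C, K * F.toReal + 8 * H.toReal + 1, by linarith, by positivity,
    fun N g hN hg hI => ?_⟩
  have hN0 : 0 < N := by linarith
  have hlogN : 1 / 2 ≤ Real.log N := by
    have := Real.log_le_log (by norm_num) hN
    linarith [Real.log_two_gt_d9]
  have hosc : 1 ≤ N ^ oscConst p N :=
    Real.one_le_rpow (by linarith) (oscConst_nonneg (fun z => by linarith [hp2 z]) hN0)
  set Λ := C * N ^ oscConst p N with hΛ
  have hΛ1 : 1 ≤ Λ := by rw [hΛ]; nlinarith
  -- Splitting at height one separates the two pointwise bounds. Only the large part uses the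
  -- division by `Λ`; since `Λ ≥ 1` it does not hurt the small part. The factor `2` in `2 * C` turns
  -- the sum of the parts into a maximum.
  set A : Set Plane := {y | 1 < g y}
  have hA : MeasurableSet A := measurableSet_lt measurable_const hg
  set g₁ := A.indicator g
  set g₂ := Aᶜ.indicator g
  have hg₁ : Measurable g₁ := hg.indicator hA
  have hg₂ : Measurable g₂ := hg.indicator hA.compl
  have hle₁ : ∀ y, g₁ y ≤ g y := fun y => Set.indicator_le_self' (fun _ _ => zero_le) y
  have hle₂ : ∀ y, g₂ y ≤ g y := fun y => Set.indicator_le_self' (fun _ _ => zero_le) y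
  have hI₁ : ∫⁻ y, g₁ y ^ p y ≤ 1 := le_trans (lintegral_mono fun y => by
    have := hp2 y
    gcongr; exact hle₁ y) hI
  have hI₂ : ∫⁻ y, g₂ y ^ p y ≤ 1 := le_trans (lintegral_mono fun y => by
    have := hp2 y
    gcongr; exact hle₂ y) hI
  set W₁ := kakeyaMax N (fun y => g₁ y ^ (p y / 2))
  set W₂ := kakeyaMax N (fun y => g₂ y ^ (p y / 2))
  set M := kakeyaMax N decay
  have hsqrt : ∀ f : Plane → ℝ≥0∞, ∀ y, (f y ^ (p y / 2)) ^ 2 = f y ^ p y := fun f y => by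
    rw [← ENNReal.rpow_natCast, ← ENNReal.rpow_mul]; congr 1; push_cast; ring
  have hW : ∀ f : Plane → ℝ≥0∞, Measurable f → ∫⁻ y, f y ^ p y ≤ 1 →
      ∫⁻ x, kakeyaMax N (fun y => f y ^ (p y / 2)) x ^ 2 ≤ ENNReal.ofReal (K * Real.log N ^ 2) := by
    intro f hf hf1
    refine (hL2 N hN _ (by fun_prop)).trans ?_
    simp only [hsqrt f]
    exact mul_le_of_le_one_right zero_le hf1
  have hM : ∫⁻ x, M x ^ 2 ≤ ENNReal.ofReal (K * Real.log N ^ 2) * H :=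
    hL2 N hN _ measurable_decay
  have hpoint : ∀ x, (kakeyaMax N g x / ENNReal.ofReal (2 * C * N ^ oscConst p N)) ^ p x ≤
      W₁ x ^ 2 + (4 * E ^ 2 * W₂ x ^ 2 + 4 * E ^ 2 * M x ^ 2 + 2 * decay x ^ 2) := by
    intro x
    have hpx := hp2 x
    have h1 := hlarge N g₁ hN hg₁ (fun y => by
      by_cases hy : y ∈ A
      · right
        simp only [g₁, Set.indicator_of_mem hy]
        exact le_of_lt hy
      · left; simp only [g₁, Set.indicator_of_notMem hy]) hI₁ x
    have h2 := hsmall N g₂ hN hg₂ (fun y => by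
      by_cases hy : y ∈ A
      · simp only [g₂, Set.indicator_of_notMem (fun h : y ∈ Aᶜ => h hy)]
        exact zero_le
      · simp only [g₂, Set.indicator_of_mem (show y ∈ Aᶜ from hy)]
        exact not_lt.1 hy) x
    have hsum : kakeyaMax N g x ≤ kakeyaMax N g₁ x + kakeyaMax N g₂ x := by
      refine le_trans (le_of_eq ?_) (kakeyaMax_add_le hg₁ x)
      congr 1; ext y
      exact (Set.indicator_self_add_compl_apply A g y).symm
    set a := kakeyaMax N g₁ x / ENNReal.ofReal Λ
    set b := kakeyaMax N g₂ x
    have hab : kakeyaMax N g x / ENNReal.ofReal (2 * C * N ^ oscConst p N) ≤ max a b := by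
      rw [mul_assoc, ← hΛ, ENNReal.ofReal_mul (by norm_num), ENNReal.ofReal_ofNat]
      refine ENNReal.div_le_of_le_mul (hsum.trans ?_)
      have hΛ0 : ENNReal.ofReal Λ ≠ 0 := (ENNReal.ofReal_pos.2 (by linarith)).ne'
      have e1 : kakeyaMax N g₁ x = a * ENNReal.ofReal Λ :=
        (ENNReal.div_mul_cancel hΛ0 ENNReal.ofReal_ne_top).symm
      have e2 : b ≤ b * ENNReal.ofReal Λ :=
        le_mul_of_one_le_right zero_le (ENNReal.one_le_ofReal.2 hΛ1)
      calc kakeyaMax N g₁ x + b ≤ a * ENNReal.ofReal Λ + b * ENNReal.ofReal Λ := by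
            rw [← e1]; gcongr
        _ ≤ max a b * ENNReal.ofReal Λ + max a b * ENNReal.ofReal Λ := by
            gcongr
            · exact le_max_left _ _
            · exact le_max_right _ _
        _ = _ := by ring
    have hmax : max a b ^ p x ≤ a ^ p x + b ^ p x := by
      rcases le_total a b with hab' | hab'
      · rw [max_eq_right hab']; exact le_add_self
      · rw [max_eq_left hab']; exact le_self_add
    calc _ ≤ max a b ^ p x := by gcongr
      _ ≤ a ^ p x + b ^ p x := hmax
      _ ≤ W₁ x ^ 2 + (E * W₂ x + E * M x + decay x) ^ 2 := add_le_add h1 h2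
      _ ≤ W₁ x ^ 2 + 2 * (2 * ((E * W₂ x) ^ 2 + (E * M x) ^ 2) + decay x ^ 2) := by
          gcongr
          refine (add_sq_le_two_mul _ _).trans ?_
          gcongr
          exact add_sq_le_two_mul _ _
      _ = _ := by ring
  have hmW₁ : Measurable W₁ := measurable_kakeyaMax hN0 _
  have hmW₂ : Measurable W₂ := measurable_kakeyaMax hN0 _
  have hmM : Measurable M := measurable_kakeyaMax hN0 _
  set Q := ENNReal.ofReal (K * Real.log N ^ 2) with hQ
  calc _ ≤ ∫⁻ x, (W₁ x ^ 2 + (4 * E ^ 2 * W₂ x ^ 2 + 4 * E ^ 2 * M x ^ 2 + 2 * decay x ^ 2)) :=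
        lintegral_mono hpoint
    _ = (∫⁻ x, W₁ x ^ 2) + (4 * E ^ 2 * (∫⁻ x, W₂ x ^ 2) + 4 * E ^ 2 * (∫⁻ x, M x ^ 2) +
          2 * H) := by
        rw [lintegral_add_left (by fun_prop), lintegral_add_left (by fun_prop),
          lintegral_add_left (by fun_prop), lintegral_const_mul _ (by fun_prop),
          lintegral_const_mul _ (by fun_prop),
          lintegral_const_mul _ (measurable_decay.pow_const 2)]
    _ ≤ Q + (4 * E ^ 2 * Q + 4 * E ^ 2 * (Q * H) + 2 * H) := by
        gcongr
        · exact hW g₁ hg₁ hI₁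
        · exact hW g₂ hg₂ hI₂
    _ = Q * F + 2 * H := by rw [hF]; ring
    _ = ENNReal.ofReal (K * Real.log N ^ 2 * F.toReal + 2 * H.toReal) := by
        rw [ENNReal.ofReal_add (by positivity) (by positivity),
          ENNReal.ofReal_mul (p := K * Real.log N ^ 2) (by positivity), ← hQ,
          ENNReal.ofReal_mul (p := 2) (by norm_num), ENNReal.ofReal_toReal hFt, ENNReal.ofReal_toReal hHt,
          ENNReal.ofReal_ofNat]
    _ ≤ _ := by
        refine ENNReal.ofReal_le_ofReal ?_
        -- The term `2 * H` free of `N` is absorbed by `8 * H * log² N`.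
        have h1 : 1 / 4 ≤ Real.log N ^ 2 := by nlinarith
        have h2 : 0 ≤ H.toReal := ENNReal.toReal_nonneg
        nlinarith

/-- The normalized modular inequality with the constant of the operator norm bound. -/
theorem exists_lintegral_kakeyaMax_rpow_le_one (hp2 : ∀ x, 2 ≤ p x) (hloc : LocallyLogHolder p)
    (hinf : LogHolderAtInfinity p) {q : ℝ} (hq : 2 ≤ q) (hqp : ∀ x, q ≤ p x) :
    ∃ C : ℝ, 0 < C ∧ ∀ (N : ℝ) (g : Plane → ℝ≥0∞), 2 ≤ N → Measurable g →
      ∫⁻ y, g y ^ p y ≤ 1 →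
      ∫⁻ x, (kakeyaMax N g x / ENNReal.ofReal
        (C * N ^ (q * oscConst p N) * Real.log N ^ (2 / q))) ^ p x ≤ 1 := by
  obtain ⟨C, D, hC, hD, h⟩ := exists_lintegral_kakeyaMax_rpow_le hp2 hloc hinf
  -- With `D' ≥ 4` and `log² N ≥ 1 / 4` one has `S ≥ 1`, needed to compare powers of `S`.
  set D' := max D 4
  have hD' : 0 < D' := by positivity
  refine ⟨C * D' ^ (1 / q), by positivity, fun N g hN hg hI => ?_⟩
  have hN0 : 0 < N := by linarith
  have hlogN : 1 / 2 ≤ Real.log N := by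
    have := Real.log_le_log (by norm_num) hN
    linarith [Real.log_two_gt_d9]
  have hosc := oscConst_nonneg (p := p) (fun z => by linarith [hp2 z]) hN0
  set S := D' * Real.log N ^ 2 with hS
  have hS1 : 1 ≤ S := by
    have h1 : 1 / 4 ≤ Real.log N ^ 2 := by nlinarith
    have h2 : 4 ≤ D' := le_max_right _ _
    rw [hS]; nlinarith
  have hS0 : 0 < S := by linarith
  set Λ := C * N ^ oscConst p N with hΛ
  have hΛ0 : 0 < Λ := by positivity
  have hA : Λ * S ^ (1 / q) ≤
      C * D' ^ (1 / q) * N ^ (q * oscConst p N) * Real.log N ^ (2 / q) := by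
    have e1 : S ^ (1 / q) = D' ^ (1 / q) * Real.log N ^ (2 / q) := by
      rw [hS, Real.mul_rpow hD'.le (by positivity), ← Real.rpow_natCast, ← Real.rpow_mul (by linarith)]
      congr 2; push_cast; ring
    -- The only place where the factor `q` enters the exponent of `N`.
    have e2 : N ^ oscConst p N ≤ N ^ (q * oscConst p N) :=
      Real.rpow_le_rpow_of_exponent_le (by linarith) (by nlinarith)
    have e3 : 0 ≤ Real.log N ^ (2 / q) := by positivity
    rw [e1, hΛ]
    calc _ = C * D' ^ (1 / q) * N ^ oscConst p N * Real.log N ^ (2 / q) := by ring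
      _ ≤ _ := by gcongr
  have hpoint : ∀ x, (kakeyaMax N g x / ENNReal.ofReal
        (C * D' ^ (1 / q) * N ^ (q * oscConst p N) * Real.log N ^ (2 / q))) ^ p x ≤
      (ENNReal.ofReal S)⁻¹ * (kakeyaMax N g x / ENNReal.ofReal Λ) ^ p x := by
    intro x
    have hpx := hp2 x
    calc _ ≤ (kakeyaMax N g x / ENNReal.ofReal (Λ * S ^ (1 / q))) ^ p x := by gcongr
      _ = ((ENNReal.ofReal (S ^ (1 / q)))⁻¹ * (kakeyaMax N g x / ENNReal.ofReal Λ)) ^ p x := by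
          rw [ENNReal.ofReal_mul hΛ0.le]
          simp only [div_eq_mul_inv]
          rw [ENNReal.mul_inv (Or.inr ENNReal.ofReal_ne_top) (Or.inl ENNReal.ofReal_ne_top)]
          congr 1; ring
      _ = (ENNReal.ofReal (S ^ (1 / q)))⁻¹ ^ p x * (kakeyaMax N g x / ENNReal.ofReal Λ) ^ p x :=
          ENNReal.mul_rpow_of_nonneg _ _ (by linarith)
      _ ≤ _ := by
          gcongr
          rw [ENNReal.inv_rpow, ENNReal.inv_le_inv, ENNReal.ofReal_rpow_of_pos (by positivity)]
          refine ENNReal.ofReal_le_ofReal ?_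
          rw [← Real.rpow_mul hS0.le]
          -- Since `p x / q ≥ 1`, dividing the function by `S ^ (1 / q)` divides the modular by at
          -- least `S`.
          calc S = S ^ (1 : ℝ) := (Real.rpow_one S).symm
            _ ≤ _ := by
              refine Real.rpow_le_rpow_of_exponent_le hS1 ?_
              rw [one_div_mul_eq_div, one_le_div (by linarith)]
              exact hqp x
  calc _ ≤ ∫⁻ x, (ENNReal.ofReal S)⁻¹ * (kakeyaMax N g x / ENNReal.ofReal Λ) ^ p x :=
        lintegral_mono hpoint
    _ = (ENNReal.ofReal S)⁻¹ * ∫⁻ x, (kakeyaMax N g x / ENNReal.ofReal Λ) ^ p x :=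
        lintegral_const_mul' _ _ (ENNReal.inv_ne_top.2 (ENNReal.ofReal_pos.2 hS0).ne')
    _ ≤ (ENNReal.ofReal S)⁻¹ * ENNReal.ofReal S := by
        gcongr
        refine (h N g hN hg hI).trans (ENNReal.ofReal_le_ofReal ?_)
        rw [hS]
        gcongr
        exact le_max_left _ _
    _ = 1 := ENNReal.inv_mul_cancel (ENNReal.ofReal_pos.2 hS0).ne' ENNReal.ofReal_ne_top

end Modular

/-! ### From the modular to the Luxemburg norm -/

section Norm

variable {p : Plane → ℝ}

/-- Since `p ≥ 1`, the factor `s⁻¹ ^ p x` is at most `s⁻¹`. Hence a finite modular becomes at most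
one after enlarging the scale. -/
theorem modular_mul_le {ε : Type*} [TopologicalSpace ε] [ContinuousENorm ε] (hp2 : ∀ x, 2 ≤ p x)
    (f : Plane → ε) {r s : ℝ} (hr : 0 < r) (hs : 1 ≤ s) :
    modular p f (r * s) ≤ ENNReal.ofReal s⁻¹ * modular p f r := by
  have hs0 : 0 < s := by linarith
  unfold modular
  rw [← lintegral_const_mul' _ _ ENNReal.ofReal_ne_top]
  refine lintegral_mono fun x => ?_
  have hpx := hp2 x
  have e : ‖f x‖ₑ / ENNReal.ofReal (r * s) = ENNReal.ofReal s⁻¹ * (‖f x‖ₑ / ENNReal.ofReal r) := by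
    rw [ENNReal.ofReal_mul hr.le, ENNReal.ofReal_inv_of_pos hs0, div_eq_mul_inv, div_eq_mul_inv,
      ENNReal.mul_inv (Or.inr ENNReal.ofReal_ne_top) (Or.inl ENNReal.ofReal_ne_top)]
    ring
  rw [e, ENNReal.mul_rpow_of_nonneg _ _ (by linarith)]
  gcongr
  calc ENNReal.ofReal s⁻¹ ^ p x ≤ ENNReal.ofReal s⁻¹ ^ (1 : ℝ) := by
        refine ENNReal.rpow_le_rpow_of_exponent_ge ?_ (by linarith)
        rw [ENNReal.ofReal_le_one]
        exact inv_le_one_of_one_le₀ hs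
    _ = _ := ENNReal.rpow_one _

theorem MemVarLp.exists_modular_le_one (hp2 : ∀ x, 2 ≤ p x) {f : Plane → ℝ}
    (hf : MemVarLp p f) : ∃ r : ℝ, 0 < r ∧ modular p f r ≤ 1 := by
  obtain ⟨-, r, hr, h⟩ := hf
  set m := modular p f r with hm
  have hs : 1 ≤ max 1 m.toReal := le_max_left _ _
  have hs0 : 0 < max 1 m.toReal := by linarith
  refine ⟨r * max 1 m.toReal, by positivity, (modular_mul_le hp2 f hr hs).trans ?_⟩
  rw [← hm, ENNReal.ofReal_inv_of_pos hs0, mul_comm, ← div_eq_mul_inv]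
  refine ENNReal.div_le_of_le_mul ?_
  rw [one_mul, ENNReal.le_ofReal_iff_toReal_le h.ne hs0.le]
  exact le_max_right _ _

theorem measurable_kakeya {N : ℝ} (hN : 0 < N) (f : Plane → ℝ) : Measurable (kakeya N f) :=
  measurable_kakeyaMax hN (fun y => ‖f y‖ₑ)

theorem modular_kakeya_le_one {N A : ℝ} (hA : 0 < A)
    (h : ∀ g : Plane → ℝ≥0∞, Measurable g → ∫⁻ y, g y ^ p y ≤ 1 →
      ∫⁻ x, (kakeyaMax N g x / ENNReal.ofReal A) ^ p x ≤ 1)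
    {f : Plane → ℝ} (hf : AEStronglyMeasurable f volume) {r : ℝ} (hr : 0 < r)
    (hfr : modular p f r ≤ 1) : modular p (kakeya N f) (A * r) ≤ 1 := by
  -- The hypothesis is for Borel functions; rectangle averages do not change under passage to an
  -- almost everywhere equal representative.
  obtain ⟨f', hf', hff'⟩ := hf
  set c := (ENNReal.ofReal r)⁻¹
  have hc : c ≠ ∞ := ENNReal.inv_ne_top.2 (ENNReal.ofReal_pos.2 hr).ne'
  have hg : Measurable fun y => ‖f' y‖ₑ * c := hf'.measurable.enorm.mul_const c
  have hae : (fun y => ‖f y‖ₑ) =ᵐ[volume] fun y => ‖f' y‖ₑ := by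
    filter_upwards [hff'] with y hy
    rw [hy]
  have hI : ∫⁻ y, (‖f' y‖ₑ * c) ^ p y ≤ 1 := by
    refine le_trans (le_of_eq ?_) hfr
    refine lintegral_congr_ae ?_
    filter_upwards [hae] with y hy
    rw [← hy, div_eq_mul_inv]
  refine le_trans (le_of_eq ?_) (h _ hg hI)
  refine lintegral_congr fun x => ?_
  have e1 : ‖kakeya N f x‖ₑ = kakeyaMax N (fun y => ‖f' y‖ₑ) x := kakeyaMax_congr_ae hae x
  rw [e1, kakeyaMax_mul_const _ hc, ENNReal.ofReal_mul hA.le]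
  simp only [div_eq_mul_inv]
  rw [ENNReal.mul_inv (Or.inr ENNReal.ofReal_ne_top) (Or.inl ENNReal.ofReal_ne_top)]
  congr 1
  ring

theorem isBoundedOp_kakeya_and_opNorm_le (hp2 : ∀ x, 2 ≤ p x) {N A : ℝ} (hN : 0 < N) (hA : 0 < A)
    (h : ∀ g : Plane → ℝ≥0∞, Measurable g → ∫⁻ y, g y ^ p y ≤ 1 →
      ∫⁻ x, (kakeyaMax N g x / ENNReal.ofReal A) ^ p x ≤ 1) :
    IsBoundedOp p (kakeya N) ∧ opNorm p (kakeya N) ≤ ENNReal.ofReal A := by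
  have hnorm : opNorm p (kakeya N) ≤ ENNReal.ofReal A := by
    refine sInf_le fun f hf => ?_
    have hA0 : ENNReal.ofReal A ≠ 0 := (ENNReal.ofReal_pos.2 hA).ne'
    rw [mul_comm, ← ENNReal.div_le_iff hA0 ENNReal.ofReal_ne_top]
    refine le_iInf fun r => le_iInf₂ fun hr hfr => ?_
    rw [ENNReal.div_le_iff hA0 ENNReal.ofReal_ne_top, ← ENNReal.ofReal_mul hr.le, mul_comm r]
    exact iInf_le_of_le (A * r) (iInf₂_le (mul_pos hA hr) (modular_kakeya_le_one hA h hf.1 hr hfr))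
  refine ⟨⟨fun f hf => ?_, hnorm.trans_lt ENNReal.ofReal_lt_top⟩, hnorm⟩
  obtain ⟨r, hr, hfr⟩ := hf.exists_modular_le_one hp2
  exact ⟨(measurable_kakeya hN f).aestronglyMeasurable, A * r, mul_pos hA hr,
    (modular_kakeya_le_one hA h hf.1 hr hfr).trans_lt ENNReal.one_lt_top⟩

end Norm

end KakeyaVar

end

/-! ### The operator norm bound -/

theorem corollary1p6 (p : KakeyaVar.Plane → ℝ) (hp : Measurable p) (hp1 : ∀ x, 1 ≤ p x)
    (h2 : 2 ≤ KakeyaVar.pMinus p) (hle : KakeyaVar.pMinus p ≤ KakeyaVar.pPlus p)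
    (hfin : KakeyaVar.pPlus p < ⊤)
    (hloc : KakeyaVar.LocallyLogHolder p) (hinf : KakeyaVar.LogHolderAtInfinity p) :
    ∃ C : ℝ, 0 < C ∧ ∀ N : ℝ, 2 ≤ N →
      KakeyaVar.IsBoundedOp p (KakeyaVar.kakeya N) ∧
      KakeyaVar.opNorm p (KakeyaVar.kakeya N) ≤
        ENNReal.ofReal (C * N ^ ((KakeyaVar.pMinus p).toReal * KakeyaVar.oscConst p N) *
          Real.log N ^ (2 / (KakeyaVar.pMinus p).toReal)) := by
  -- `toReal` sends `±∞` to `0`; both values are excluded, so `q` is the essential infimum itself.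
  have hbot : KakeyaVar.pMinus p ≠ ⊥ := fun h =>
    absurd (h2.trans_eq h) (not_le.2 (EReal.bot_lt_coe 2))
  have hcoe : (((KakeyaVar.pMinus p).toReal : ℝ) : EReal) = KakeyaVar.pMinus p :=
    EReal.coe_toReal (hle.trans_lt hfin).ne hbot
  set q := (KakeyaVar.pMinus p).toReal
  have hq : 2 ≤ q := by
    rw [← hcoe] at h2
    exact EReal.coe_le_coe_iff.1 h2
  have hqp : ∀ x, q ≤ p x := KakeyaVar.le_of_le_pMinus hloc.continuous hcoe.le
  have hp2 : ∀ x, 2 ≤ p x := fun x => hq.trans (hqp x)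
  obtain ⟨C, hC, h⟩ := KakeyaVar.exists_lintegral_kakeyaMax_rpow_le_one hp2 hloc hinf hq hqp
  refine ⟨C, hC, fun N hN => ?_⟩
  have hN0 : 0 < N := by linarith
  have hlog : 0 < Real.log N := Real.log_pos (by linarith)
  exact KakeyaVar.isBoundedOp_kakeya_and_opNorm_le hp2 hN0 (by positivity) fun g => h N g hN
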